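/- Model. The network is the complete graph on $n$ nodes. Each node has $n-1$ ports, numbered $0,\dots,n-2$, leading to the other nodes; the assignment of ports to neighbours is arbitrary and fixed before any coin is tossed. All nodes know $n$ and run the same randomized protocol, with private independent unbiased coins. The network is either anonymous (nodes have no identifiers) or the nodes have pairwise distinct natural numbers as identifiers, fixed before any coin is tossed, each node knowing only its own. Communication is synchronous: in each round an awake, non-terminated node tosses coins and may send one message through each port, and messages arrive at the end of the round. All nodes are initially asleep. A node wakes up when an adversary wakes it at the beginning of a round, or when it receives a message. The adversary is adaptive: the set of nodes it wakes in a round may depend on all coin flips of earlier rounds; it may leave nodes asleep forever, but it wakes at least one. Nodes have no global clock; rounds are counted from the first wake-up. Leader election is achieved if exactly one node decides that it is elected and every other node decides that it is not elected and knows which of its ports leads to the leader and, if there are identifiers, the identifier of the leader. Theorem. There are a randomized leader election algorithm (one protocol for each $n$) and constants $c>0$ and $C,K\in\mathbb N$ such that for every $n$, every port assignment and every wake-up adversary: (a) In the anonymous network, with certainty, all $n$ nodes have terminated after 9 rounds, and all messages have at most $K\lfloor\log_2 n\rfloor$ bits. With probability at least $1-1/n^c$ a unique leader is elected, and with probability at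 least $1-1/n^c$ at most $Cn$ messages are sent in total. (b) In the network with arbitrary pairwise distinct identifiers, with certainty, all $n$ nodes have terminated after 9 rounds and a unique leader is elected. With probability at least $1-1/n^c$ at most $Cn$ messages are sent in total. If moreover the identifiers are at most $n^k$ for a constant $k$, then all messages have at most $K_k\lfloor\log_2 n\rfloor$ bits, where the constant $K_k$ depends only on $k$. -/

import Mathlib

open MeasureTheory

namespace SyncElection

/-- The final decision of a node: it is the leader, or it is not the leader and knows which of its
ports leads to the leader and which identifier the leader has (`none` in an anonymous network). -/
inductive Outcome (n : ℕ) where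
  | elected : Outcome n
  | nonElected (leaderPort : Fin (n - 1)) (leaderId : Option ℕ) : Outcome n

/-- A randomized synchronous protocol for the complete network on `n` nodes. All nodes run the same
protocol; a node sees only its own identifier (if there is one), its own coins and its ports
`0, …, n - 2`. A message is a natural number, `Nat.size` is its number of bits; at most one
message per port is sent in a round. There is no global clock: a node starts in the state
`start id spontaneous` when it wakes up. -/
structure Protocol (n : ℕ) where
  /-- local states of an awake node -/
  State : Type
  /-- number of fair coins that an awake node tosses in each round -/
  coins : ℕ
  /-- state upon waking up, from the node's own identifier and from the information whether the
  node was woken up by the adversary (`true`) or by a message (`false`) -/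
  start : Option ℕ → Bool → State
  /-- first half of a round: toss coins, update the state, send messages -/
  send : State → (Fin coins → Bool) → State × (Fin (n - 1) → Option ℕ)
  /-- second half of a round: update the state from the messages that arrived -/
  receive : State → (Fin (n - 1) → Option ℕ) → State
  /-- the decision; a node has terminated once this is not `none` -/
  decision : State → Option (Outcome n)

/-- A port numbering of the complete graph: `ports v p` is the neighbour of `v` behind port `p`. -/
abbrev Ports (n : ℕ) := (v : Fin n) → Fin (n - 1) ≃ {u : Fin n // u ≠ v}

/-- The coins of one round: `b` bits for each of the `n` nodes. -/
abbrev RoundCoins (n b : ℕ) := Fin n → Fin b → Bool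

/-- The coins of all rounds. -/
abbrev CoinSpace (n b : ℕ) := ℕ → RoundCoins n b

/-- All coins of all nodes in all rounds are independent and unbiased. -/
noncomputable def coinMeasure (n b : ℕ) : Measure (CoinSpace n b) :=
  Measure.infinitePi fun _ : ℕ => (PMF.uniformOfFintype (RoundCoins n b)).toMeasure

/-- An adaptive wake-up adversary: the set of nodes that it wakes up at the beginning of round `t`
may depend on all coins of the rounds before `t`. Rounds are counted from the first wake-up, so a
node is woken up in round `0`. -/
structure Adversary (n b : ℕ) where
  wake : (t : ℕ) → (Fin t → RoundCoins n b) → Finset (Fin n)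
  wake_zero : ∀ h, (wake 0 h).Nonempty

section Run

variable {n : ℕ} (P : Protocol n) (ports : Ports n) (ids : Fin n → Option ℕ)

/-- The state of every node; `none` is a sleeping node. -/
abbrev Config := Fin n → Option P.State

/-- The messages that are in transit in a round: `out v p` is sent by `v` through its port `p`. -/
abbrev Outgoing (n : ℕ) := Fin n → Fin (n - 1) → Option ℕ

/-- The sleeping nodes of `W` wake up spontaneously. -/
def wakeUp (W : Finset (Fin n)) (c : Config P) : Config P := fun v =>
  match c v with
  | some s => some s
  | none => if v ∈ W then some (P.start (ids v) true) else none

/-- The messages sent by the awake nodes that have not terminated. -/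
def outgoing (c : Config P) (r : RoundCoins n P.coins) : Outgoing n := fun v p =>
  match c v with
  | some s => if (P.decision s).isSome then none else (P.send s (r v)).2 p
  | none => none

/-- The state update that goes with sending. -/
def afterSend (c : Config P) (r : RoundCoins n P.coins) : Config P := fun v =>
  match c v with
  | some s => if (P.decision s).isSome then some s else some (P.send s (r v)).1
  | none => none

/-- What `v` receives through its port `p`: the message that the neighbour `u` behind this port
sends through the port of `u` that leads to `v`. -/
def inbox (out : Outgoing n) (v : Fin n) (p : Fin (n - 1)) : Option ℕ :=
  out (ports v p).1 ((ports (ports v p).1).symm ⟨v, (ports v p).2.symm⟩)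

/-- Delivery at the end of the round. A sleeping node that receives a message wakes up; a node that
has terminated does nothing any more. -/
def deliver (out : Outgoing n) (c : Config P) : Config P := fun v =>
  match c v with
  | some s => if (P.decision s).isSome then some s else some (P.receive s (inbox ports out v))
  | none =>
    if ∃ p, inbox ports out v p ≠ none then
      some (P.receive (P.start (ids v) false) (inbox ports out v))
    else none

variable (adv : Adversary n P.coins) (ω : CoinSpace n P.coins)

/-- The configuration after the wake-ups at the beginning of round `t`, if `c` was the configuration
before them. -/
def awake (t : ℕ) (c : Config P) : Config P :=
  wakeUp P ids (adv.wake t fun s => ω s) c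

/-- The configuration after the rounds `0, …, t - 1`. -/
def config : ℕ → Config P
  | 0 => fun _ => none
  | t + 1 =>
    deliver P ports ids (outgoing P (awake P ids adv ω t (config t)) (ω t))
      (afterSend P (awake P ids adv ω t (config t)) (ω t))

/-- The messages sent in round `t`. -/
def sent (t : ℕ) : Outgoing n :=
  outgoing P (awake P ids adv ω t (config P ports ids adv ω t)) (ω t)

/-- The number of messages sent in the rounds `0, …, T - 1`. -/
def messageCount (T : ℕ) : ℕ :=
  ∑ t ∈ Finset.range T, ∑ v, ∑ p, if (sent P ports ids adv ω t v p).isSome then 1 else 0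

/-- The decision of node `v` after `t` rounds, if it has one. -/
def decisionAt (t : ℕ) (v : Fin n) : Option (Outcome n) :=
  (config P ports ids adv ω t v).bind P.decision

/-- All nodes have terminated after `t` rounds. -/
def TerminatedAt (t : ℕ) : Prop :=
  ∀ v, (decisionAt P ports ids adv ω t v).isSome

/-- After `t` rounds exactly one node `l` is elected, and every other node has decided that it is
not elected and knows the identity of `l`. -/
def ElectedAt (t : ℕ) : Prop :=
  ∃ l, decisionAt P ports ids adv ω t l = some .elected ∧
    ∀ v, v ≠ l → ∃ p, (ports v p : Fin n) = l ∧
      decisionAt P ports ids adv ω t v = some (.nonElected p (ids l))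

/-- All messages that are ever sent have at most `B` bits. -/
def MessageBitsLE (B : ℕ) : Prop :=
  ∀ t v p m, sent P ports ids adv ω t v p = some m → Nat.size m ≤ B

end Run

/-- The network is anonymous: no node has an identifier. -/
def anonymous {n : ℕ} : Fin n → Option ℕ := fun _ => none

/-- The nodes have the identifiers `ident v`. -/
def withIds {n : ℕ} (ident : Fin n → ℕ) : Fin n → Option ℕ := fun v => some (ident v)

/-- `E` holds with probability at least `1 - 1 / n ^ c`. -/
def HoldsWhp (n b : ℕ) (c : ℝ) (E : CoinSpace n b → Prop) : Prop :=
  1 - 1 / (n : ℝ) ^ c ≤ (coinMeasure n b).real {ω | E ω}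

end SyncElection

namespace SyncElection

/-! ### The protocol -/

/-! Write B for `base n = 2 ^ scale n`, which is `n ^ (1/16)` up to a factor 2. Let R be the first
round with a candidate. The election is settled by the candidates of round R alone: they send their
keys to random referees in round R, a referee refuses in round R + 1 every key below the largest
that it received, and the unrefused candidates (`Winner`) announce themselves to everybody in round
R + 2. The candidate with the largest key is never refused (`Quiet.exists_winner`), so every other
node, asleep or not, receives an announcement and decides. A node woken in round 0 volunteers at the
latest when its clock shows 6, so R ≤ 6 and nine rounds suffice. If the keys are distinct, all nodes
agree on the winner with the largest key (`electedAt_nine`). Identifiers are always distinct; random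
ranks of about `4 * log n` bits are distinct with high probability. Failure of any other random
event costs only messages, never correctness.

Few messages: volunteering has probability B^-10, B^-5, 1 at clock 0, 3, 6, and each port is picked
with probability B^-7. The expected numbers of common referees of two nodes is about B^2, so with
high probability at most one winner announces itself. All n ≤ (2B)^16 nodes together send O(n / B)
requests at clock 0 in expectation. A group of more than B^11 nodes woken together almost surely
contains a candidate at once; a smaller one sends at most B^11 * B^-5 * n * B^-7 = n / B requests in
expectation at clock 3. Likewise a group of more than B^6 nodes almost surely has a candidate at
clock 3, and a smaller one sends at most n / B requests in expectation at clock 6. The stages are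
three rounds apart, as long as one election: requests sent in rounds R to R + 2 come from groups
whose previous stage fell before R and produced no candidate (`Quiet.card_asks_le`).

The adversary is adaptive, but the group woken in round t is determined by the coins before t, hence
independent of the coins in rounds t, t + 3 and t + 6 (`coinMeasure_fresh_le`). Markov's inequality
and union bounds give failure probability O(1 / B), which is at most `n ^ (-1/32)` for large n;
small n are absorbed into the constant C. -/

/-- The activity of a node: `asking` while it sends its requests, `waiting` while its referees
answer, `ready` when it announces itself. -/
inductive Role where
  | idle : Role
  | asking (key : ℕ) : Role
  | waiting (key : ℕ) : Role
  | ready (key : ℕ) : Role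

/-- The local state of a node. The clock counts the rounds since a spontaneous wake-up; it is `none`
for a node that was woken up by a message. The mail consists of the messages that arrived in the
last round. -/
structure NodeState (n : ℕ) where
  id : Option ℕ
  clock : Option ℕ
  role : Role
  mail : Fin (n - 1) → Option ℕ
  outcome : Option (Outcome n)

/-- A candidate asks a referee for support. -/
def request (k : ℕ) : ℕ := 2 * k + 1

/-- A candidate announces that no referee objected. -/
def announcement (k : ℕ) : ℕ := 2 * k + 2

/-- A referee knows a better candidate. -/
def refusal : ℕ := 0

@[simp] lemma request_inj {k l : ℕ} : request k = request l ↔ k = l := by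
  simp [request]

@[simp] lemma announcement_inj {k l : ℕ} : announcement k = announcement l ↔ k = l := by
  simp [announcement]

@[simp] lemma request_ne_announcement {k l : ℕ} : request k ≠ announcement l := by
  simp only [request, announcement]; omega

@[simp] lemma announcement_ne_request {k l : ℕ} : announcement k ≠ request l := by
  simp only [request, announcement]; omega

@[simp] lemma request_ne_refusal {k : ℕ} : request k ≠ refusal := by
  simp [request, refusal]

@[simp] lemma refusal_ne_request {k : ℕ} : refusal ≠ request k := by
  simp [request, refusal]

@[simp] lemma announcement_ne_refusal {k : ℕ} : announcement k ≠ refusal := by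
  simp [announcement, refusal]

@[simp] lemma refusal_ne_announcement {k : ℕ} : refusal ≠ announcement k := by
  simp [announcement, refusal]

/-- The probabilities of the protocol are powers of `2 ^ scale n`, which is about `n ^ (1 / 16)`. -/
def scale (n : ℕ) : ℕ := Nat.log 2 n / 16

/-- The number of bits of a random rank. -/
def rankBits (n : ℕ) : ℕ := 4 * (Nat.log 2 n + 1)

/-- The purposes of the coins of one node in one round. -/
abbrev CoinIndex (n : ℕ) : Type :=
  (Fin (10 * scale n) ⊕ Fin (5 * scale n)) ⊕ ((Fin (n - 1) × Fin (7 * scale n)) ⊕ Fin (rankBits n))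

/-- The number of coins of one node in one round. -/
abbrev coinCount (n : ℕ) : ℕ := Fintype.card (CoinIndex n)

/-- The position of the coin for a given purpose. -/
noncomputable def coinAt {n : ℕ} (i : CoinIndex n) : Fin (coinCount n) := Fintype.equivFin _ i

section Coins

variable {n : ℕ} (x : Fin (coinCount n) → Bool)

/-- An event of probability `2 ^ (-10 * scale n)`. -/
def Rare : Prop := ∀ i, x (coinAt (.inl (.inl i))) = true

/-- An event of probability `2 ^ (-5 * scale n)`. -/
def Moderate : Prop := ∀ i, x (coinAt (.inl (.inr i))) = true

/-- The node behind port `p` is chosen as a referee; this has probability `2 ^ (-7 * scale n)`. -/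
def Picks (p : Fin (n - 1)) : Prop := ∀ i, x (coinAt (.inr (.inl (p, i)))) = true

/-- A random number of `rankBits n` bits. -/
noncomputable def rank : ℕ := Nat.ofBits fun i : Fin (rankBits n) => x (coinAt (.inr (.inr i)))

/-- A node becomes a candidate with small probability when its clock shows `0`, with higher
probability when its clock shows `3`, and with certainty when its clock shows `6`. -/
def Volunteers (clock : Option ℕ) : Prop :=
  clock = some 0 ∧ Rare x ∨ clock = some 3 ∧ Moderate x ∨ clock = some 6

/-- The key by which candidates are compared: the identifier or else a random rank. -/
noncomputable def keyOf (id : Option ℕ) : ℕ := id.getD (rank x)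

end Coins

namespace NodeState

variable {n : ℕ}

/-- The state upon waking up. -/
def initial (id : Option ℕ) (spontaneous : Bool) : NodeState n where
  id := id
  clock := if spontaneous then some 0 else none
  role := .idle
  mail := fun _ => none
  outcome := none

/-- The answers of a referee: it refuses every candidate but the best. -/
noncomputable def reply (st : NodeState n) (p : Fin (n - 1)) : Option ℕ :=
  open Classical in
  if ∃ k q l, st.mail p = some (request k) ∧ st.mail q = some (request l) ∧ k < l then
    some refusal
  else none

/-- The node has been asked for support in the last round. -/
def HasRequest (st : NodeState n) : Prop := ∃ p k, st.mail p = some (request k)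

/-- The first half of a round. -/
noncomputable def send (st : NodeState n) (x : Fin (coinCount n) → Bool) :
    NodeState n × (Fin (n - 1) → Option ℕ) :=
  open Classical in
  match st.role with
  | .ready k => (st, fun _ => some (announcement k))
  | .idle =>
    if st.HasRequest then (st, st.reply)
    else if Volunteers x st.clock then
      ({ st with role := .asking (keyOf x st.id) },
        fun p => if Picks x p then some (request (keyOf x st.id)) else none)
    else (st, fun _ => none)
  | _ => (st, st.reply)

/-- The port `p` brought an announcement with the key `k`, and `k` is maximal. -/
def Best (mail : Fin (n - 1) → Option ℕ) (p : Fin (n - 1)) (k : ℕ) : Prop :=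
  mail p = some (announcement k) ∧ ∀ q l, mail q = some (announcement l) → l ≤ k

/-- The decision after a round, from the own role and the messages that arrived. -/
noncomputable def judge (id : Option ℕ) (role : Role) (mail : Fin (n - 1) → Option ℕ) :
    Option (Outcome n) :=
  open Classical in
  -- Non-strict: winners with equal maximal keys all become elected. Distinctness of the keys is
  -- what excludes this.
  if ∃ k, role = .ready k ∧ ∀ q l, mail q = some (announcement l) → l ≤ k then some .elected
  else if h : ∃ p k, Best mail p k then
    some (.nonElected h.choose (id.map fun _ => h.choose_spec.choose))
  else none

/-- The role after a round. -/
noncomputable def nextRole (role : Role) (mail : Fin (n - 1) → Option ℕ) : Role :=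
  open Classical in
  match role with
  | .asking k => .waiting k
  | .waiting k => if ∃ p, mail p = some refusal then .idle else .ready k
  | r => r

/-- The second half of a round. -/
noncomputable def receive (st : NodeState n) (mail : Fin (n - 1) → Option ℕ) : NodeState n where
  id := st.id
  clock := st.clock.map (· + 1)
  role := nextRole st.role mail
  mail := mail
  outcome := judge st.id st.role mail

end NodeState

/-- The leader election protocol. -/
noncomputable def election (n : ℕ) : Protocol n where
  State := NodeState n
  coins := coinCount n
  start := NodeState.initial
  send := NodeState.send
  receive := NodeState.receive
  decision := NodeState.outcome

/-! ### Single rounds -/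

section Run

variable {n : ℕ} (ports : Ports n) (ids : Fin n → Option ℕ) (adv : Adversary n (coinCount n))
  (ω : CoinSpace n (coinCount n))

/-- The states after the rounds before round `t`. -/
noncomputable def conf (t : ℕ) (v : Fin n) : Option (NodeState n) :=
  config (election n) ports ids adv ω t v

/-- The states in round `t` after the spontaneous wake-ups. -/
noncomputable def woken (t : ℕ) (v : Fin n) : Option (NodeState n) :=
  awake (election n) ids adv ω t (config (election n) ports ids adv ω t) v

/-- The messages sent in round `t`. -/
noncomputable def msgs (t : ℕ) : Outgoing n := sent (election n) ports ids adv ω t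

/-- The messages that arrive at `v` in round `t`. -/
noncomputable def arrivals (t : ℕ) (v : Fin n) : Fin (n - 1) → Option ℕ :=
  inbox ports (msgs ports ids adv ω t) v

variable {ports ids adv ω} {t : ℕ} {v : Fin n} {st : NodeState n}

lemma woken_of_some (h : conf ports ids adv ω t v = some st) :
    woken ports ids adv ω t v = some st := by
  change config (election n) ports ids adv ω t v = some st at h
  simp only [woken, awake, wakeUp, h]
  rfl

lemma woken_of_none (h : conf ports ids adv ω t v = none) :
    woken ports ids adv ω t v =
      if v ∈ adv.wake t (fun s => ω s) then some (NodeState.initial (ids v) true) else none := by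
  change config (election n) ports ids adv ω t v = none at h
  simp only [woken, awake, wakeUp, h]
  rfl

lemma msgs_of_none (h : woken ports ids adv ω t v = none) (p : Fin (n - 1)) :
    msgs ports ids adv ω t v p = none := by
  change awake (election n) ids adv ω t (config (election n) ports ids adv ω t) v = none at h
  simp only [msgs, sent, outgoing, h]

lemma msgs_of_some (h : woken ports ids adv ω t v = some st) (p : Fin (n - 1)) :
    msgs ports ids adv ω t v p = if st.outcome.isSome then none else (st.send (ω t v)).2 p := by
  change awake (election n) ids adv ω t (config (election n) ports ids adv ω t) v = some st at h
  simp only [msgs, sent, outgoing, h]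
  rfl

lemma conf_succ_of_none (h : woken ports ids adv ω t v = none) :
    conf ports ids adv ω (t + 1) v =
      if ∃ p, arrivals ports ids adv ω t v p ≠ none then
        some ((NodeState.initial (ids v) false).receive (arrivals ports ids adv ω t v))
      else none := by
  change awake (election n) ids adv ω t (config (election n) ports ids adv ω t) v = none at h
  simp only [conf, config, deliver, afterSend, h]
  rfl

lemma conf_succ_of_decided (h : woken ports ids adv ω t v = some st) (hd : st.outcome.isSome) :
    conf ports ids adv ω (t + 1) v = some st := by
  change awake (election n) ids adv ω t (config (election n) ports ids adv ω t) v = some st at h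
  have hd' : ((election n).decision st).isSome := hd
  simp only [conf, config, deliver, afterSend, h, hd', if_true]
  rfl

lemma send_outcome (st : NodeState n) (x : Fin (coinCount n) → Bool) :
    (st.send x).1.outcome = st.outcome := by
  unfold NodeState.send
  split <;> try rfl
  split_ifs <;> rfl

lemma conf_succ_of_some (h : woken ports ids adv ω t v = some st) (hd : st.outcome = none) :
    conf ports ids adv ω (t + 1) v =
      some ((st.send (ω t v)).1.receive (arrivals ports ids adv ω t v)) := by
  change awake (election n) ids adv ω t (config (election n) ports ids adv ω t) v = some st at h
  have hd' : (election n).decision st = none := hd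
  have hd2 : (election n).decision ((election n).send st (ω t v)).1 = none := by
    rw [← hd]; exact send_outcome _ _
  simp only [conf, config, deliver, afterSend, h, hd', hd2, Option.isSome_none, if_false,
    Bool.false_eq_true]
  rfl

/-! ### The port through which an edge is traversed backwards -/

/-- The other end of the link at port `p` of `v`. -/
def reverseEnd (ports : Ports n) (e : Fin n × Fin (n - 1)) : Fin n × Fin (n - 1) :=
  ((ports e.1 e.2).1, (ports (ports e.1 e.2).1).symm ⟨e.1, (ports e.1 e.2).2.symm⟩)

lemma arrivals_eq (v : Fin n) (p : Fin (n - 1)) :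
    arrivals ports ids adv ω t v p =
      msgs ports ids adv ω t (reverseEnd ports (v, p)).1 (reverseEnd ports (v, p)).2 := rfl

lemma ports_reverseEnd (e : Fin n × Fin (n - 1)) :
    (ports (reverseEnd ports e).1 (reverseEnd ports e).2).1 = e.1 := by
  exact congrArg Subtype.val
    ((ports (ports e.1 e.2).1).apply_symm_apply ⟨e.1, (ports e.1 e.2).2.symm⟩)

lemma reverseEnd_reverseEnd (e : Fin n × Fin (n - 1)) :
    reverseEnd ports (reverseEnd ports e) = e := by
  have h1 := ports_reverseEnd (ports := ports) e
  have key : ∀ (u : Fin n) (hu : (reverseEnd ports e).1 ≠ u), u = e.1 →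
      (u, (ports u).symm ⟨(reverseEnd ports e).1, hu⟩) = e := by
    rintro u hu rfl
    ext1
    · rfl
    · simp [reverseEnd]
  exact key _ _ h1

lemma arrivals_reverseEnd (v : Fin n) (p : Fin (n - 1)) :
    arrivals ports ids adv ω t (reverseEnd ports (v, p)).1 (reverseEnd ports (v, p)).2 =
      msgs ports ids adv ω t v p := by
  rw [arrivals_eq, reverseEnd_reverseEnd]

/-- The port of `u` that leads to `v`. -/
def portTo (ports : Ports n) {u v : Fin n} (h : v ≠ u) : Fin (n - 1) := (ports u).symm ⟨v, h⟩

lemma ports_portTo {u v : Fin n} (h : v ≠ u) : (ports u (portTo ports h) : Fin n) = v := by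
  simp [portTo]

lemma arrivals_portTo {u v : Fin n} (h : v ≠ u) :
    arrivals ports ids adv ω t u (portTo ports h) = msgs ports ids adv ω t v (portTo ports h.symm) := by
  have : reverseEnd ports (v, portTo ports h.symm) = (u, portTo ports h) := by
    have h1 : (ports v (portTo ports h.symm) : Fin n) = u := ports_portTo h.symm
    ext1
    · exact h1
    · simp only [reverseEnd]
      have : ∀ (w : Fin n) (hw : v ≠ w), w = u → (ports w).symm ⟨v, hw⟩ = portTo ports h := by
        rintro w hw rfl; rfl
      exact this _ _ h1
  have h2 := arrivals_reverseEnd (ports := ports) (ids := ids) (adv := adv) (ω := ω) (t := t) v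
    (portTo ports h.symm)
  rw [this] at h2
  exact h2

end Run

section Run

variable {n : ℕ} (ports : Ports n) (ids : Fin n → Option ℕ) (adv : Adversary n (coinCount n))
  (ω : CoinSpace n (coinCount n))

/-! ### Invariants -/

/-- The nodes that the adversary wakes up in round `t`, but in no earlier round. -/
noncomputable def fresh (t : ℕ) : Finset (Fin n) :=
  open Classical in
  Finset.univ.filter fun v =>
    v ∈ adv.wake t (fun s => ω s) ∧ ∀ s < t, v ∉ adv.wake s (fun r => ω r)

/-- `v` becomes a candidate in round `t`. -/
def Candidate (t : ℕ) (v : Fin n) : Prop :=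
  ∃ st, woken ports ids adv ω t v = some st ∧ st.outcome = none ∧ Volunteers (ω t v) st.clock

variable {ports ids adv ω} {t : ℕ} {v : Fin n} {st : NodeState n}

lemma mem_fresh : v ∈ fresh adv ω t ↔
    v ∈ adv.wake t (fun s => ω s) ∧ ∀ s < t, v ∉ adv.wake s (fun r => ω r) := by
  simp [fresh]

/-- `fresh` refers to the adversary only and not to the configuration, so it is a function of the
earlier coins. The probability estimates rest on this. -/
lemma fresh_congr {ω' : CoinSpace n (coinCount n)} (h : ∀ s < t, ω s = ω' s) :
    fresh adv ω t = fresh adv ω' t := by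
  have key : ∀ s ≤ t, (fun r : Fin s => ω r) = fun r : Fin s => ω' r := fun s hs => by
    funext r; exact h r (by omega)
  ext v
  simp only [mem_fresh]
  rw [key t le_rfl]
  constructor <;> rintro ⟨h1, h2⟩ <;> refine ⟨h1, fun s hs => ?_⟩
  · rw [← key s hs.le]; exact h2 s hs
  · rw [key s hs.le]; exact h2 s hs

lemma send_id (st : NodeState n) (x : Fin (coinCount n) → Bool) : (st.send x).1.id = st.id := by
  unfold NodeState.send
  split <;> try rfl
  split_ifs <;> rfl

lemma send_clock (st : NodeState n) (x : Fin (coinCount n) → Bool) :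
    (st.send x).1.clock = st.clock := by
  unfold NodeState.send
  split <;> try rfl
  split_ifs <;> rfl

/-- What holds for the local state of `v` before round `t`. -/
structure Sound (ports : Ports n) (ids : Fin n → Option ℕ) (adv : Adversary n (coinCount n))
    (ω : CoinSpace n (coinCount n)) (t : ℕ) (v : Fin n) (st : NodeState n) : Prop where
  id_eq : st.id = ids v
  -- Restricted to undecided nodes, since clock and mail of a terminated node are frozen while `t`
  -- runs on.
  clock_le : st.outcome = none → ∀ s, st.clock = some s → s ≤ t ∧ v ∈ fresh adv ω (t - s)
  mail_eq : st.outcome = none → ∀ p m, st.mail p = some m →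
    ∃ s, t = s + 1 ∧ arrivals ports ids adv ω s v p = some m

lemma not_mem_wake_of_conf_none (h : conf ports ids adv ω t v = none) :
    ∀ s < t, v ∉ adv.wake s (fun r => ω r) := by
  induction t with
  | zero => intro s hs; omega
  | succ t ih =>
    intro s hs
    rcases hw : woken ports ids adv ω t v with _ | st
    · rcases hc : conf ports ids adv ω t v with _ | st
      · rw [woken_of_none hc] at hw
        rcases Nat.lt_succ_iff_lt_or_eq.1 hs with h1 | rfl
        · exact ih hc s h1
        · by_contra hv
          rw [if_pos hv] at hw
          cases hw
      · rw [woken_of_some hc] at hw; cases hw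
    · rcases ho : st.outcome with _ | o
      · rw [conf_succ_of_some hw ho] at h; cases h
      · rw [conf_succ_of_decided hw (by simp [ho])] at h; cases h

lemma sound_woken_of_sound_conf (ih : ∀ st, conf ports ids adv ω t v = some st →
    Sound ports ids adv ω t v st) (h : woken ports ids adv ω t v = some st) :
    Sound ports ids adv ω t v st := by
  rcases hc : conf ports ids adv ω t v with _ | st'
  · rw [woken_of_none hc] at h
    split_ifs at h with hv
    cases h
    refine ⟨rfl, fun _ s hs => ?_, fun _ p m hm => ?_⟩
    · cases hs
      exact ⟨Nat.zero_le _, mem_fresh.2 ⟨hv, not_mem_wake_of_conf_none hc⟩⟩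
    · cases hm
  · rw [woken_of_some hc] at h
    cases h
    exact ih _ hc

lemma sound_conf (h : conf ports ids adv ω t v = some st) : Sound ports ids adv ω t v st := by
  induction t generalizing st with
  | zero => cases h
  | succ t ih =>
    rcases hw : woken ports ids adv ω t v with _ | st'
    · rw [conf_succ_of_none hw] at h
      split_ifs at h with hp
      cases h
      exact ⟨rfl, fun _ s hs => (by cases hs), fun _ p m hm => ⟨t, rfl, hm⟩⟩
    · have hs := sound_woken_of_sound_conf (fun _ => ih) hw
      rcases ho : st'.outcome with _ | o
      · rw [conf_succ_of_some hw ho] at h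
        cases h
        refine ⟨(send_id _ _).trans hs.id_eq, fun _ s hs' => ?_, fun _ p m hm => ⟨t, rfl, hm⟩⟩
        simp only [NodeState.receive, send_clock, Option.map_eq_some_iff] at hs'
        obtain ⟨r, hr, rfl⟩ := hs'
        obtain ⟨h1, h2⟩ := hs.clock_le ho r hr
        exact ⟨by omega, by simpa using h2⟩
      · rw [conf_succ_of_decided hw (by simp [ho])] at h
        cases h
        refine ⟨hs.id_eq, fun h => ?_, fun h => ?_⟩ <;> rw [ho] at h <;> cases h

lemma sound_woken (h : woken ports ids adv ω t v = some st) : Sound ports ids adv ω t v st :=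
  sound_woken_of_sound_conf (fun _ => sound_conf) h

/-! ### The messages of a node -/

lemma msgs_cases {p : Fin (n - 1)} {m : ℕ} (h : msgs ports ids adv ω t v p = some m) :
    ∃ st, woken ports ids adv ω t v = some st ∧ st.outcome = none ∧
      ((∃ k, st.role = .ready k ∧ m = announcement k) ∨
        (m = refusal ∧ ∃ k q l, st.mail p = some (request k) ∧ st.mail q = some (request l) ∧
          k < l) ∨
        (st.role = .idle ∧ Volunteers (ω t v) st.clock ∧ Picks (ω t v) p ∧
          m = request (keyOf (ω t v) (ids v)))) := by
  rcases hw : woken ports ids adv ω t v with _ | st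
  · rw [msgs_of_none hw] at h; cases h
  rcases ho : st.outcome with _ | o
  swap
  · rw [msgs_of_some hw] at h; simp [ho] at h
  refine ⟨st, rfl, ho, ?_⟩
  rw [msgs_of_some hw, ho] at h
  simp only [Option.isSome_none, Bool.false_eq_true, if_false] at h
  have hreply : st.reply p = some m → m = refusal ∧ ∃ k q l, st.mail p = some (request k) ∧
      st.mail q = some (request l) ∧ k < l := by
    intro hr
    unfold NodeState.reply at hr
    split_ifs at hr with hk
    cases hr
    exact ⟨rfl, hk⟩
  unfold NodeState.send at h
  split at h
  · rename_i k hk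
    left
    exact ⟨k, hk, by simpa using h.symm⟩
  · rename_i hk
    split_ifs at h with h1 h2
    · exact .inr (.inl (hreply h))
    · simp only at h
      split_ifs at h with hp
      right; right
      refine ⟨hk, h2, hp, ?_⟩
      rw [← (sound_woken hw).id_eq]
      simpa using h.symm
  · exact .inr (.inl (hreply h))

lemma candidate_of_msgs_request {p : Fin (n - 1)} {k : ℕ}
    (h : msgs ports ids adv ω t v p = some (request k)) :
    Candidate ports ids adv ω t v ∧ Picks (ω t v) p ∧ k = keyOf (ω t v) (ids v) := by
  obtain ⟨st, hw, ho, h | h | h⟩ := msgs_cases h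
  · obtain ⟨l, -, h⟩ := h
    simp at h
  · simp at h
  · exact ⟨⟨st, hw, ho, h.2.1⟩, h.2.2.1, by simpa using h.2.2.2⟩

/-- Every message is a request, an answer to a request, or an announcement. -/
lemma msgs_classification {p : Fin (n - 1)} (h : msgs ports ids adv ω t v p ≠ none) :
    (Candidate ports ids adv ω t v ∧ Picks (ω t v) p) ∨
    (∃ s, t = s + 1 ∧ Candidate ports ids adv ω s (reverseEnd ports (v, p)).1 ∧
      Picks (ω s (reverseEnd ports (v, p)).1) (reverseEnd ports (v, p)).2) ∨
    ∃ st k, woken ports ids adv ω t v = some st ∧ st.role = .ready k ∧ st.outcome = none := by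
  obtain ⟨m, hm⟩ := Option.ne_none_iff_exists'.1 h
  obtain ⟨st, hw, ho, ⟨k, hk, -⟩ | ⟨-, k, q, l, hk, -, -⟩ | ⟨-, h1, h2, -⟩⟩ := msgs_cases hm
  · exact .inr (.inr ⟨st, k, hw, hk, ho⟩)
  · obtain ⟨s, rfl, hs⟩ := (sound_woken hw).mail_eq ho p _ hk
    rw [arrivals_eq] at hs
    exact .inr (.inl ⟨s, rfl, (candidate_of_msgs_request hs).1, (candidate_of_msgs_request hs).2.1⟩)
  · exact .inl ⟨⟨st, hw, ho, h1⟩, h2⟩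

/-- The keys that nodes store are keys of candidates, so they obey every bound on such keys. -/
lemma role_key_lt {B : ℕ} (hB : ∀ t v, keyOf (ω t v) (ids v) < B)
    (h : conf ports ids adv ω t v = some st) {k : ℕ}
    (hk : st.role = .asking k ∨ st.role = .waiting k ∨ st.role = .ready k) : k < B := by
  induction t generalizing st k with
  | zero => cases h
  | succ t ih =>
    rcases hw : woken ports ids adv ω t v with _ | st'
    · rw [conf_succ_of_none hw] at h
      split_ifs at h with hp
      cases h
      simp [NodeState.receive, NodeState.initial, NodeState.nextRole] at hk
    have ih' : ∀ k, st'.role = .asking k ∨ st'.role = .waiting k ∨ st'.role = .ready k →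
        k < B := by
      intro k hk
      rcases hc : conf ports ids adv ω t v with _ | st2
      · rw [woken_of_none hc] at hw
        split_ifs at hw
        cases hw
        simp [NodeState.initial] at hk
      · rw [woken_of_some hc] at hw
        cases hw
        exact ih hc hk
    rcases ho : st'.outcome with _ | o
    swap
    · rw [conf_succ_of_decided hw (by simp [ho])] at h
      cases h
      exact ih' _ hk
    have hsend : ∀ k, (st'.send (ω t v)).1.role = .asking k ∨
        (st'.send (ω t v)).1.role = .waiting k ∨ (st'.send (ω t v)).1.role = .ready k → k < B := by
      intro k hk
      unfold NodeState.send at hk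
      split at hk
      · exact ih' k hk
      · rename_i hr
        split_ifs at hk
        · exact ih' k hk
        · have : k = keyOf (ω t v) st'.id := by simpa [eq_comm] using hk
          rw [this, (sound_woken hw).id_eq]
          exact hB t v
        · exact ih' k hk
      · exact ih' k hk
    rw [conf_succ_of_some hw ho] at h
    cases h
    apply hsend
    simp only [NodeState.receive, NodeState.nextRole] at hk
    split at hk
    · rename_i l hl
      left
      rw [hl]
      simpa using hk
    · rename_i l hl
      right; left
      rw [hl]
      split_ifs at hk
      · simp at hk
      · simpa using hk
    · exact hk

lemma woken_role_key_lt {B : ℕ} (hB : ∀ t v, keyOf (ω t v) (ids v) < B)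
    (h : woken ports ids adv ω t v = some st) {k : ℕ} (hk : st.role = .ready k) : k < B := by
  rcases hc : conf ports ids adv ω t v with _ | st'
  · rw [woken_of_none hc] at h
    split_ifs at h
    cases h
    cases hk
  · rw [woken_of_some hc] at h
    cases h
    exact role_key_lt hB hc (.inr (.inr hk))

lemma msgs_le {B : ℕ} (hB : ∀ t v, keyOf (ω t v) (ids v) < B) {p : Fin (n - 1)} {m : ℕ}
    (h : msgs ports ids adv ω t v p = some m) : m ≤ 2 * B := by
  obtain ⟨st, hw, ho, ⟨k, hk, rfl⟩ | ⟨rfl, -⟩ | ⟨-, -, -, rfl⟩⟩ := msgs_cases h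
  · have := woken_role_key_lt hB hw hk
    simp only [announcement]; omega
  · simp [refusal]
  · have := hB t v
    simp only [request]; omega

/-! ### The rounds before the first candidate -/

variable (ports ids adv ω) in
/-- There is no candidate before round `t`. -/
def Quiet (t : ℕ) : Prop := ∀ s < t, ∀ v, ¬ Candidate ports ids adv ω s v

/-- The state of a node that has been awake for `c` rounds without ever being a candidate. -/
def idleState (id : Option ℕ) (c : ℕ) : NodeState n := ⟨id, some c, .idle, fun _ => none, none⟩

lemma woken_of_conf_idle (ih : ∀ st, conf ports ids adv ω t v = some st →
      ∃ c, st = idleState (ids v) c) (h : woken ports ids adv ω t v = some st) :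
    ∃ c, st = idleState (ids v) c := by
  rcases hc : conf ports ids adv ω t v with _ | st'
  · rw [woken_of_none hc] at h
    split_ifs at h
    cases h
    exact ⟨0, rfl⟩
  · rw [woken_of_some hc] at h
    cases h
    exact ih _ hc

lemma send_idleState {id : Option ℕ} {c : ℕ} {x : Fin (coinCount n) → Bool}
    (h : ¬ Volunteers x (some c)) :
    (idleState id c : NodeState n).send x = (idleState id c, fun _ => none) := by
  simp [NodeState.send, idleState, NodeState.HasRequest, h]

/-- Without candidates nothing is ever sent: refusals need requests and announcements need former
candidates. So nobody is woken by a message and all mail is empty. -/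
lemma Quiet.conf_idle (hq : Quiet ports ids adv ω t) {st : NodeState n}
    (h : conf ports ids adv ω t v = some st) : ∃ c, st = idleState (ids v) c := by
  induction t generalizing v st with
  | zero => cases h
  | succ t ih =>
    have hq' : Quiet ports ids adv ω t := fun s hs => hq s (by omega)
    have hmid : ∀ v st, woken ports ids adv ω t v = some st →
        (∃ c, st = idleState (ids v) c) ∧ (st.send (ω t v)) = (st, fun _ => none) := by
      intro v st hst
      obtain ⟨c, rfl⟩ := woken_of_conf_idle (fun st => ih hq') hst
      refine ⟨⟨c, rfl⟩, send_idleState fun hv => hq t (by omega) v ⟨_, hst, rfl, hv⟩⟩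
    have hmsg : ∀ v p, msgs ports ids adv ω t v p = none := by
      intro v p
      rcases hw : woken ports ids adv ω t v with _ | st
      · exact msgs_of_none hw p
      · rw [msgs_of_some hw, (hmid v st hw).2, ite_self]
    have harr : ∀ v, arrivals ports ids adv ω t v = fun _ => none := by
      intro v; funext p; rw [arrivals_eq, hmsg]
    rcases hw : woken ports ids adv ω t v with _ | st'
    · rw [conf_succ_of_none hw, harr] at h
      simp at h
    · obtain ⟨⟨c, rfl⟩, hs⟩ := hmid v st' hw
      rw [conf_succ_of_some hw rfl, hs, harr] at h
      cases h
      refine ⟨c + 1, ?_⟩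
      simp [NodeState.receive, idleState, NodeState.nextRole, NodeState.judge, NodeState.Best]

lemma Quiet.woken_idle (hq : Quiet ports ids adv ω t) (h : woken ports ids adv ω t v = some st) :
    ∃ c, st = idleState (ids v) c :=
  woken_of_conf_idle (fun _ => hq.conf_idle) h

lemma Quiet.msgs_eq_none (hq : Quiet ports ids adv ω (t + 1)) (v : Fin n) (p : Fin (n - 1)) :
    msgs ports ids adv ω t v p = none := by
  have hq' : Quiet ports ids adv ω t := fun s hs => hq s (by omega)
  by_contra h
  obtain ⟨h, -⟩ | ⟨s, rfl, h, -⟩ | ⟨st, k, hw, hk, -⟩ := msgs_classification h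
  · exact hq t (by omega) v h
  · exact hq s (by omega) _ h
  · obtain ⟨c, rfl⟩ := hq'.woken_idle hw
    cases hk

/-- As long as there is no candidate, the nodes woken up in round `t` have been awake for `c` rounds
in round `t + c`. -/
lemma Quiet.woken_add {c : ℕ} (hq : Quiet ports ids adv ω (t + c)) (hv : v ∈ fresh adv ω t) :
    woken ports ids adv ω (t + c) v = some (idleState (ids v) c) := by
  induction c with
  | zero =>
    rw [mem_fresh] at hv
    rw [Nat.add_zero] at hq ⊢
    rcases hc : conf ports ids adv ω t v with _ | st
    · rw [woken_of_none hc, if_pos hv.1]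
      rfl
    · exfalso
      obtain ⟨c, rfl⟩ := hq.conf_idle hc
      have h1 := (sound_conf hc).clock_le rfl c rfl
      -- A state left by a completed round has its clock already advanced, so it cannot show 0. A
      -- positive clock means an earlier wake-up, against freshness.
      rcases Nat.eq_zero_or_pos c with rfl | hc0
      · clear h1
        rcases t with _ | t
        · cases hc
        · rcases hw : woken ports ids adv ω t v with _ | st
          · rw [conf_succ_of_none hw] at hc
            split_ifs at hc
            cases hc
          · rcases ho : st.outcome with _ | o
            · rw [conf_succ_of_some hw ho] at hc
              have := congrArg (fun o => o.map NodeState.clock) hc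
              simp [NodeState.receive, idleState] at this
            · rw [conf_succ_of_decided hw (by simp [ho])] at hc
              cases hc
              cases ho
      · exact hv.2 (t - c) (by omega) (mem_fresh.1 h1.2).1
  | succ c ih =>
    have hq' : Quiet ports ids adv ω (t + c) := fun s hs => hq s (by omega)
    have hw := ih hq'
    have hnv : ¬ Volunteers (ω (t + c) v) (some c) :=
      fun h => hq (t + c) (by omega) v ⟨_, hw, rfl, h⟩
    have harr : arrivals ports ids adv ω (t + c) v = fun _ => none := by
      funext p; rw [arrivals_eq, Quiet.msgs_eq_none (by rwa [add_assoc])]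
    rw [← add_assoc]
    apply woken_of_some
    rw [conf_succ_of_some hw rfl, send_idleState hnv, harr]
    simp [NodeState.receive, idleState, NodeState.nextRole, NodeState.judge, NodeState.Best]

/-- A node woken by the adversary in round 0 reaches clock 6 in round 6 if nothing happens before,
and then it volunteers with certainty. -/
lemma exists_candidate : ∃ R ≤ 6, Quiet ports ids adv ω R ∧ ∃ v, Candidate ports ids adv ω R v := by
  classical
  by_cases h : ∃ t < 6, ∃ v, Candidate ports ids adv ω t v
  · refine ⟨Nat.find h, (Nat.find_spec h).1.le, fun s hs v hv => ?_, (Nat.find_spec h).2⟩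
    exact Nat.find_min h hs ⟨hs.trans (Nat.find_spec h).1, v, hv⟩
  · have hq : Quiet ports ids adv ω 6 := fun s hs v hv => h ⟨s, hs, v, hv⟩
    obtain ⟨v, hv⟩ := adv.wake_zero fun s => ω s
    have hf : v ∈ fresh adv ω 0 := mem_fresh.2 ⟨hv, fun s hs => absurd hs (Nat.not_lt_zero s)⟩
    have hw := Quiet.woken_add (c := 6) (t := 0) hq hf
    exact ⟨6, le_rfl, hq, v, _, hw, rfl, .inr (.inr rfl)⟩

end Run

section Run

variable {n : ℕ} {ports : Ports n} {ids : Fin n → Option ℕ} {adv : Adversary n (coinCount n)}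
  {ω : CoinSpace n (coinCount n)} {R t : ℕ} {v : Fin n} {st : NodeState n}

/-! ### The round of the first candidates -/

lemma Quiet.msgs_eq (hq : Quiet ports ids adv ω R) (hc : Candidate ports ids adv ω R v)
    {p : Fin (n - 1)} (hp : Picks (ω R v) p) :
    msgs ports ids adv ω R v p = some (request (keyOf (ω R v) (ids v))) := by
  obtain ⟨st, hw, ho, hvol⟩ := hc
  obtain ⟨c, rfl⟩ := hq.woken_idle hw
  rw [msgs_of_some hw]
  replace hvol : Volunteers (ω R v) (some c) := hvol
  simp [NodeState.send, idleState, NodeState.HasRequest, hvol, hp]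

lemma Quiet.msgs_request (hq : Quiet ports ids adv ω R) {p : Fin (n - 1)} {m : ℕ}
    (h : msgs ports ids adv ω R v p = some m) : ∃ k, m = request k := by
  obtain ⟨st, hw, ho, ⟨k, hk, -⟩ | ⟨-, k, q, l, hk, -, -⟩ | ⟨-, -, -, h⟩⟩ := msgs_cases h
  · obtain ⟨c, rfl⟩ := hq.woken_idle hw; cases hk
  · obtain ⟨c, rfl⟩ := hq.woken_idle hw; cases hk
  · exact ⟨_, h⟩

lemma judge_eq_none {id : Option ℕ} {role : Role} {mail : Fin (n - 1) → Option ℕ}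
    (hr : ∀ k, role ≠ .ready k) (hm : ∀ p k, mail p ≠ some (announcement k)) :
    NodeState.judge id role mail = none := by
  unfold NodeState.judge
  rw [if_neg, dif_neg]
  · rintro ⟨p, k, h, -⟩; exact hm p k h
  · rintro ⟨k, h, -⟩; exact hr k h

/-- The state of a node in the round after the first candidates have sent their requests. -/
structure AfterRequests (ports : Ports n) (ids : Fin n → Option ℕ) (adv : Adversary n (coinCount n))
    (ω : CoinSpace n (coinCount n)) (R : ℕ) (v : Fin n) (st : NodeState n) : Prop where
  outcome_eq : st.outcome = none
  mail_eq : st.mail = arrivals ports ids adv ω R v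
  role_of_candidate : Candidate ports ids adv ω R v →
    st.role = .waiting (keyOf (ω R v) (ids v))
  role_of_not : ¬ Candidate ports ids adv ω R v → st.role = .idle

lemma Quiet.conf_succ (hq : Quiet ports ids adv ω R)
    (h : conf ports ids adv ω (R + 1) v = some st) : AfterRequests ports ids adv ω R v st := by
  have harr : ∀ p k, arrivals ports ids adv ω R v p ≠ some (announcement k) := by
    intro p k h
    rw [arrivals_eq] at h
    obtain ⟨l, hl⟩ := hq.msgs_request h
    simp at hl
  rcases hw : woken ports ids adv ω R v with _ | st'
  · rw [conf_succ_of_none hw] at h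
    split_ifs at h with hp
    cases h
    refine ⟨judge_eq_none (by simp [NodeState.initial]) harr, rfl, ?_, fun _ => rfl⟩
    rintro ⟨st, hst, -⟩
    rw [hw] at hst
    cases hst
  · obtain ⟨c, rfl⟩ := hq.woken_idle hw
    rw [conf_succ_of_some hw rfl] at h
    by_cases hvol : Volunteers (ω R v) (some c)
    · have hs : ((idleState (ids v) c : NodeState n).send (ω R v)).1 =
          { (idleState (ids v) c) with role := .asking (keyOf (ω R v) (ids v)) } := by
        simp [NodeState.send, idleState, NodeState.HasRequest, hvol]
      rw [hs] at h
      cases h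
      refine ⟨judge_eq_none (by simp) harr, rfl, fun _ => rfl, fun hn => ?_⟩
      exact absurd ⟨_, hw, rfl, hvol⟩ hn
    · rw [send_idleState hvol] at h
      cases h
      refine ⟨judge_eq_none (by simp [idleState]) harr, rfl, ?_, fun _ => rfl⟩
      rintro ⟨st, hst, -, hv⟩
      rw [hw] at hst
      cases hst
      exact absurd hv hvol

lemma Candidate.exists_conf_succ (hc : Candidate ports ids adv ω R v) :
    ∃ st, conf ports ids adv ω (R + 1) v = some st := by
  obtain ⟨st, hw, ho, -⟩ := hc
  exact ⟨_, conf_succ_of_some hw ho⟩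

lemma arrivals_of_conf_none (h : conf ports ids adv ω (t + 1) v = none) (p : Fin (n - 1)) :
    arrivals ports ids adv ω t v p = none := by
  by_contra hp
  rcases hw : woken ports ids adv ω t v with _ | st
  · rw [conf_succ_of_none hw, if_pos ⟨p, hp⟩] at h
    cases h
  · rcases ho : st.outcome with _ | o
    · rw [conf_succ_of_some hw ho] at h; cases h
    · rw [conf_succ_of_decided hw (by simp [ho])] at h; cases h

/-! ### The answers of the referees -/

lemma Quiet.woken_succ (hq : Quiet ports ids adv ω R)
    (h : woken ports ids adv ω (R + 1) v = some st) : AfterRequests ports ids adv ω R v st := by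
  rcases hc : conf ports ids adv ω (R + 1) v with _ | st'
  · rw [woken_of_none hc] at h
    split_ifs at h
    cases h
    refine ⟨rfl, ?_, fun hn => ?_, fun _ => rfl⟩
    -- The node is woken by the adversary only now and has empty mail. This is correct because a
    -- message in round `R` would have woken it already.
    · funext p; rw [arrivals_of_conf_none hc]; rfl
    · obtain ⟨st, hst⟩ := hn.exists_conf_succ
      rw [hc] at hst; cases hst
  · rw [woken_of_some hc] at h
    cases h
    exact hq.conf_succ hc

lemma Quiet.msgs_succ_ne_announcement (hq : Quiet ports ids adv ω R) {p : Fin (n - 1)} {k : ℕ} :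
    msgs ports ids adv ω (R + 1) v p ≠ some (announcement k) := by
  intro h
  obtain ⟨st, hw, ho, ⟨k, hk, -⟩ | ⟨h, -⟩ | ⟨-, -, -, h⟩⟩ := msgs_cases h
  · by_cases hc : Candidate ports ids adv ω R v
    · rw [(hq.woken_succ hw).role_of_candidate hc] at hk; cases hk
    · rw [(hq.woken_succ hw).role_of_not hc] at hk; cases hk
  · simp at h
  · simp at h

lemma Quiet.refuses (hq : Quiet ports ids adv ω R) {w : Fin n} {p q : Fin (n - 1)} {k l : ℕ}
    (hp : arrivals ports ids adv ω R w p = some (request k))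
    (hr : arrivals ports ids adv ω R w q = some (request l)) (hkl : k < l) :
    msgs ports ids adv ω (R + 1) w p = some refusal := by
  rcases hc : conf ports ids adv ω (R + 1) w with _ | st
  · rw [arrivals_of_conf_none hc] at hp; cases hp
  have hA := hq.conf_succ hc
  have hw := woken_of_some hc
  rw [← hA.mail_eq] at hp hr
  have hreply : st.reply p = some refusal := if_pos ⟨k, q, l, hp, hr, hkl⟩
  rw [msgs_of_some hw, hA.outcome_eq]
  simp only [Option.isSome_none, Bool.false_eq_true, if_false]
  by_cases hcand : Candidate ports ids adv ω R w
  · simp only [NodeState.send, hA.role_of_candidate hcand, hreply]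
  · simp only [NodeState.send, hA.role_of_not hcand]
    rw [if_pos ⟨p, k, hp⟩]
    exact hreply

lemma Quiet.refused (hq : Quiet ports ids adv ω R) {w : Fin n} {p : Fin (n - 1)}
    (h : msgs ports ids adv ω (R + 1) w p = some refusal) :
    ∃ k q l, arrivals ports ids adv ω R w p = some (request k) ∧
      arrivals ports ids adv ω R w q = some (request l) ∧ k < l := by
  obtain ⟨st, hw, ho, ⟨k, -, h⟩ | ⟨-, h⟩ | ⟨-, -, -, h⟩⟩ := msgs_cases h
  · simp at h
  · rwa [(hq.woken_succ hw).mail_eq] at h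
  · simp at h

/-! ### The winners -/

variable (ports ids adv ω R v) in
/-- `v` is a candidate of round `R` that no referee refuses. -/
def Winner : Prop :=
  Candidate ports ids adv ω R v ∧ ∀ p, arrivals ports ids adv ω (R + 1) v p ≠ some refusal

/-- A refusal is caused by a request with a strictly larger key, and in round `R` all requests come
from candidates of that round. Hence a candidate with maximal key is safe. -/
lemma Quiet.exists_winner (hq : Quiet ports ids adv ω R)
    (h : ∃ v, Candidate ports ids adv ω R v) : ∃ v, Winner ports ids adv ω R v := by
  classical
  obtain ⟨v, hv, hmax⟩ := Finset.exists_max_image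
    (Finset.univ.filter fun v => Candidate ports ids adv ω R v)
    (fun v => keyOf (ω R v) (ids v)) (by obtain ⟨v, hv⟩ := h; exact ⟨v, by simpa using hv⟩)
  simp only [Finset.mem_filter, Finset.mem_univ, true_and] at hv hmax
  refine ⟨v, hv, fun p hp => ?_⟩
  rw [arrivals_eq] at hp
  obtain ⟨k, q, l, hk, hl, hkl⟩ := hq.refused hp
  rw [arrivals_reverseEnd] at hk
  rw [arrivals_eq] at hl
  obtain ⟨-, -, rfl⟩ := candidate_of_msgs_request hk
  obtain ⟨hu, -, rfl⟩ := candidate_of_msgs_request hl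
  exact absurd (hmax _ hu) (by simpa using hkl)

/-- Candidates with different keys and a common referee do not both win. -/
lemma Quiet.not_winner (hq : Quiet ports ids adv ω R) {u w : Fin n} (hwu : w ≠ u) (hwv : w ≠ v)
    (hu : Candidate ports ids adv ω R u) (hv : Candidate ports ids adv ω R v)
    (hpu : Picks (ω R u) (portTo ports hwu)) (hpv : Picks (ω R v) (portTo ports hwv))
    (hlt : keyOf (ω R u) (ids u) < keyOf (ω R v) (ids v)) : ¬ Winner ports ids adv ω R u := by
  intro h
  apply h.2 (portTo ports hwu)
  rw [arrivals_portTo]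
  have h1 := hq.msgs_eq hu hpu
  have h2 := hq.msgs_eq hv hpv
  rw [← arrivals_portTo hwu.symm] at h1
  rw [← arrivals_portTo hwv.symm] at h2
  exact hq.refuses h1 h2 hlt

/-- The state of a node in the round in which the winners announce themselves. -/
structure AfterReplies (ports : Ports n) (ids : Fin n → Option ℕ) (adv : Adversary n (coinCount n))
    (ω : CoinSpace n (coinCount n)) (R : ℕ) (v : Fin n) (st : NodeState n) : Prop where
  outcome_eq : st.outcome = none
  role_eq : ∀ k, st.role = .ready k ↔ Winner ports ids adv ω R v ∧ k = keyOf (ω R v) (ids v)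

lemma send_role_ready {x : Fin (coinCount n) → Bool} {k : ℕ} :
    (st.send x).1.role = .ready k ↔ st.role = .ready k := by
  unfold NodeState.send
  split
  · rfl
  · rename_i h
    split_ifs <;> simp [h]
  · rfl

lemma Quiet.conf_add_two (hq : Quiet ports ids adv ω R)
    (h : conf ports ids adv ω (R + 2) v = some st) : AfterReplies ports ids adv ω R v st := by
  have harr : ∀ p k, arrivals ports ids adv ω (R + 1) v p ≠ some (announcement k) := by
    intro p k h
    rw [arrivals_eq] at h
    exact hq.msgs_succ_ne_announcement h
  rcases hw : woken ports ids adv ω (R + 1) v with _ | st'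
  · rw [conf_succ_of_none hw] at h
    split_ifs at h with hp
    cases h
    refine ⟨judge_eq_none (by simp [NodeState.initial]) harr, fun k => ?_⟩
    simp only [NodeState.receive, NodeState.initial, NodeState.nextRole, reduceCtorEq, false_iff]
    rintro ⟨⟨hc, -⟩, -⟩
    obtain ⟨st, hst⟩ := hc.exists_conf_succ
    rw [woken_of_some hst] at hw
    cases hw
  · have hA := hq.woken_succ hw
    rw [conf_succ_of_some hw hA.outcome_eq] at h
    cases h
    by_cases hc : Candidate ports ids adv ω R v
    · have hr := hA.role_of_candidate hc
      have hs : ((st'.send (ω (R + 1) v)).1).role = .waiting (keyOf (ω R v) (ids v)) := by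
        simp only [NodeState.send, hr]
      refine ⟨judge_eq_none (by simp [hs]) harr, fun k => ?_⟩
      simp only [NodeState.receive, NodeState.nextRole, hs]
      split_ifs with hp
      · simp only [false_iff]
        rintro ⟨⟨-, h⟩, -⟩
        obtain ⟨p, hp⟩ := hp
        exact h p hp
      · simp only [Role.ready.injEq, Winner, hc, true_and]
        push Not at hp
        constructor
        · rintro rfl; exact ⟨hp, rfl⟩
        · rintro ⟨-, rfl⟩; rfl
    · have hr := hA.role_of_not hc
      -- A node that volunteers as late as round `R + 1` is only `waiting` in round `R + 2`, so it
      -- cannot compete with the winners of round `R`.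
      have hs : ((st'.send (ω (R + 1) v)).1).role = .idle ∨
          ∃ k, ((st'.send (ω (R + 1) v)).1).role = .asking k := by
        simp only [NodeState.send, hr]
        split_ifs
        · exact .inl hr
        · exact .inr ⟨_, rfl⟩
        · exact .inl hr
      have hnr : ∀ k, ((st'.send (ω (R + 1) v)).1).role ≠ .ready k := by
        intro k hk
        obtain h | ⟨l, h⟩ := hs <;> rw [h] at hk <;> cases hk
      refine ⟨judge_eq_none hnr harr, fun k => ?_⟩
      simp only [NodeState.receive]
      have : ¬ Winner ports ids adv ω R v := fun h => hc h.1
      simp only [this, false_and, iff_false]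
      obtain h | ⟨l, h⟩ := hs <;> rw [h] <;> simp [NodeState.nextRole]

lemma Winner.exists_conf_add_two (hq : Quiet ports ids adv ω R) (h : Winner ports ids adv ω R v) :
    ∃ st, conf ports ids adv ω (R + 2) v = some st := by
  obtain ⟨st, hst⟩ := h.1.exists_conf_succ
  exact ⟨_, conf_succ_of_some (woken_of_some hst) (hq.conf_succ hst).outcome_eq⟩

lemma Quiet.woken_add_two (hq : Quiet ports ids adv ω R)
    (h : woken ports ids adv ω (R + 2) v = some st) : AfterReplies ports ids adv ω R v st := by
  rcases hc : conf ports ids adv ω (R + 2) v with _ | st'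
  · rw [woken_of_none hc] at h
    split_ifs at h
    cases h
    refine ⟨rfl, fun k => ⟨fun h => (by cases h), fun h => ?_⟩⟩
    obtain ⟨st, hst⟩ := h.1.exists_conf_add_two hq
    rw [hc] at hst; cases hst
  · rw [woken_of_some hc] at h
    cases h
    exact hq.conf_add_two hc

lemma Quiet.msgs_announcement (hq : Quiet ports ids adv ω R) {p : Fin (n - 1)} {k : ℕ}
    (h : msgs ports ids adv ω (R + 2) v p = some (announcement k)) :
    Winner ports ids adv ω R v ∧ k = keyOf (ω R v) (ids v) := by
  obtain ⟨st, hw, ho, ⟨l, hl, h⟩ | ⟨h, -⟩ | ⟨-, -, -, h⟩⟩ := msgs_cases h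
  · obtain rfl := announcement_inj.1 h
    exact ((hq.woken_add_two hw).role_eq k).1 hl
  · simp at h
  · simp at h

lemma Winner.msgs_eq (hq : Quiet ports ids adv ω R) (h : Winner ports ids adv ω R v)
    (p : Fin (n - 1)) : msgs ports ids adv ω (R + 2) v p =
      some (announcement (keyOf (ω R v) (ids v))) := by
  obtain ⟨st, hst⟩ := h.exists_conf_add_two hq
  have hA := hq.conf_add_two hst
  rw [msgs_of_some (woken_of_some hst), hA.outcome_eq]
  simp only [Option.isSome_none, Bool.false_eq_true, if_false, NodeState.send,
    (hA.role_eq _).2 ⟨h, rfl⟩]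

/-! ### The decision -/

/-- The form with a separate `role` treats sleeping nodes like awake ones: a sleeping node is woken
by the announcement of a winner and judges with role `idle`. -/
lemma Quiet.conf_add_three (hq : Quiet ports ids adv ω R)
    (h : ∃ v, Candidate ports ids adv ω R v) (v : Fin n) :
    ∃ st role, conf ports ids adv ω (R + 3) v = some st ∧
      st.outcome = NodeState.judge (ids v) role (arrivals ports ids adv ω (R + 2) v) ∧
      ∀ k, role = .ready k ↔ Winner ports ids adv ω R v ∧ k = keyOf (ω R v) (ids v) := by
  rcases hw : woken ports ids adv ω (R + 2) v with _ | st
  · have hv : ¬ Winner ports ids adv ω R v := by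
      intro hv
      obtain ⟨st, hst⟩ := hv.exists_conf_add_two hq
      rw [woken_of_some hst] at hw
      cases hw
    obtain ⟨l, hl⟩ := hq.exists_winner h
    have hlv : l ≠ v := by rintro rfl; exact hv hl
    refine ⟨(NodeState.initial (ids v) false).receive (arrivals ports ids adv ω (R + 2) v), .idle,
      ?_, rfl, fun k => ?_⟩
    · rw [conf_succ_of_none hw, if_pos]
      exact ⟨portTo ports hlv, by rw [arrivals_portTo, hl.msgs_eq hq]; simp⟩
    · simp [hv]
  · have hA := hq.woken_add_two hw
    refine ⟨_, (st.send (ω (R + 2) v)).1.role, conf_succ_of_some hw hA.outcome_eq, ?_, fun k => ?_⟩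
    · simp only [NodeState.receive, send_id, (sound_woken hw).id_eq]
    · rw [send_role_ready, hA.role_eq]

lemma exists_best {mail : Fin (n - 1) → Option ℕ} (h : ∃ p k, mail p = some (announcement k)) :
    ∃ p k, NodeState.Best mail p k := by
  classical
  obtain ⟨p, hp, hmax⟩ := Finset.exists_max_image
    (Finset.univ.filter fun p => ∃ k, mail p = some (announcement k)) (fun p => (mail p).getD 0)
    (by obtain ⟨p, hp⟩ := h; exact ⟨p, by simpa using hp⟩)
  simp only [Finset.mem_filter, Finset.mem_univ, true_and] at hp hmax
  obtain ⟨k, hk⟩ := hp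
  refine ⟨p, k, hk, fun q l hl => ?_⟩
  have := hmax q ⟨l, hl⟩
  rw [hk, hl] at this
  simp only [Option.getD_some, announcement] at this
  omega

lemma judge_isSome {id : Option ℕ} {role : Role} {mail : Fin (n - 1) → Option ℕ}
    (h : (∃ k, role = .ready k) ∨ ∃ p k, mail p = some (announcement k)) :
    (NodeState.judge id role mail).isSome := by
  unfold NodeState.judge
  split_ifs with h1 h2
  · rfl
  · rfl
  · exfalso
    by_cases hm : ∃ p k, mail p = some (announcement k)
    · exact h2 (exists_best hm)
    · obtain ⟨k, hk⟩ := h.resolve_right hm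
      exact h1 ⟨k, hk, fun q l hl => absurd ⟨q, l, hl⟩ hm⟩

/-- A winner announces itself through all its ports, so each node is this winner or hears from it.
-/
lemma Quiet.decided (hq : Quiet ports ids adv ω R) (h : ∃ v, Candidate ports ids adv ω R v)
    (v : Fin n) : ∃ st, conf ports ids adv ω (R + 3) v = some st ∧ st.outcome.isSome := by
  obtain ⟨st, role, hst, ho, hr⟩ := hq.conf_add_three h v
  refine ⟨st, hst, ?_⟩
  rw [ho]
  apply judge_isSome
  obtain ⟨l, hl⟩ := hq.exists_winner h
  by_cases hlv : l = v
  · subst hlv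
    exact .inl ⟨_, (hr _).2 ⟨hl, rfl⟩⟩
  · exact .inr ⟨portTo ports hlv, _, by rw [arrivals_portTo, hl.msgs_eq hq]⟩

lemma conf_of_decided (h : conf ports ids adv ω t v = some st) (ho : st.outcome.isSome) (s : ℕ) :
    conf ports ids adv ω (t + s) v = some st := by
  induction s with
  | zero => exact h
  | succ s ih => exact conf_succ_of_decided (woken_of_some ih) ho

lemma Quiet.msgs_of_ge (hq : Quiet ports ids adv ω R) (h : ∃ v, Candidate ports ids adv ω R v)
    (ht : R + 3 ≤ t) (v : Fin n) (p : Fin (n - 1)) : msgs ports ids adv ω t v p = none := by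
  obtain ⟨st, hst, ho⟩ := hq.decided h v
  obtain ⟨s, rfl⟩ := Nat.exists_eq_add_of_le ht
  rw [msgs_of_some (woken_of_some (conf_of_decided hst ho s)), if_pos ho]

lemma decisionAt_eq : decisionAt (election n) ports ids adv ω t v =
    (conf ports ids adv ω t v).bind NodeState.outcome := rfl

lemma Quiet.decisionAt_nine (hq : Quiet ports ids adv ω R) (hR : R ≤ 6)
    (h : ∃ v, Candidate ports ids adv ω R v) :
    decisionAt (election n) ports ids adv ω 9 v =
      decisionAt (election n) ports ids adv ω (R + 3) v := by
  obtain ⟨st, hst, ho⟩ := hq.decided h v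
  have h9 := conf_of_decided hst ho (6 - R)
  rw [show R + 3 + (6 - R) = 9 by omega] at h9
  rw [decisionAt_eq, decisionAt_eq, h9, hst]

theorem terminatedAt_nine : TerminatedAt (election n) ports ids adv ω 9 := by
  intro v
  obtain ⟨R, hR, hq, hc⟩ := exists_candidate (ports := ports) (ids := ids) (adv := adv) (ω := ω)
  obtain ⟨st, hst, ho⟩ := hq.decided hc v
  rw [hq.decisionAt_nine hR hc, decisionAt_eq, hst]
  exact ho

/-- If the keys are pairwise distinct and contain the identifiers, then a leader is elected. -/
theorem electedAt_nine
    (hkey : ∀ t ≤ 6, ∀ u v, keyOf (ω t u) (ids u) = keyOf (ω t v) (ids v) → u = v)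
    (hid : ∀ t u v, (ids v).map (fun _ => keyOf (ω t u) (ids u)) = ids u) :
    ElectedAt (election n) ports ids adv ω 9 := by
  classical
  obtain ⟨R, hR, hq, hc⟩ := exists_candidate (ports := ports) (ids := ids) (adv := adv) (ω := ω)
  obtain ⟨l, hl, hmax⟩ := Finset.exists_max_image
    (Finset.univ.filter fun v => Winner ports ids adv ω R v)
    (fun v => keyOf (ω R v) (ids v))
    (by obtain ⟨v, hv⟩ := hq.exists_winner hc; exact ⟨v, by simpa using hv⟩)
  simp only [Finset.mem_filter, Finset.mem_univ, true_and] at hl hmax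
  have hsender : ∀ v p k, arrivals ports ids adv ω (R + 2) v p = some (announcement k) →
      Winner ports ids adv ω R (ports v p : Fin n) ∧
        k = keyOf (ω R (ports v p : Fin n)) (ids (ports v p : Fin n)) := by
    intro v p k h
    rw [arrivals_eq] at h
    exact hq.msgs_announcement h
  refine ⟨l, ?_, fun v hv => ?_⟩
  · obtain ⟨st, role, hst, ho, hr⟩ := hq.conf_add_three hc l
    rw [hq.decisionAt_nine hR hc, decisionAt_eq, hst]
    refine ho.trans (if_pos ⟨_, (hr _).2 ⟨hl, rfl⟩, fun q k hk => ?_⟩)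
    obtain ⟨h1, rfl⟩ := hsender _ _ _ hk
    exact hmax _ h1
  · obtain ⟨st, role, hst, ho, hr⟩ := hq.conf_add_three hc v
    have hlmsg : arrivals ports ids adv ω (R + 2) v (portTo ports hv.symm) =
        some (announcement (keyOf (ω R l) (ids l))) := by
      rw [arrivals_portTo, hl.msgs_eq hq]
    have hne : ¬ ∃ k, role = .ready k ∧ ∀ q l',
        arrivals ports ids adv ω (R + 2) v q = some (announcement l') → l' ≤ k := by
      rintro ⟨k, hk, hle⟩
      obtain ⟨hwv, rfl⟩ := (hr k).1 hk
      -- A second node calling itself elected would be a winner whose key is at least that of `l`,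
      -- which is maximal; distinct keys make it equal to `l`.
      exact hv (hkey R hR _ _ (le_antisymm (hmax v hwv) (hle _ _ hlmsg)))
    have hbest := exists_best ⟨_, _, hlmsg⟩
    have hspec := hbest.choose_spec.choose_spec
    obtain ⟨hw, hk⟩ := hsender _ _ _ hspec.1
    have hkl : hbest.choose_spec.choose = keyOf (ω R l) (ids l) :=
      le_antisymm (hk ▸ hmax _ hw) (hspec.2 _ _ hlmsg)
    refine ⟨hbest.choose, hkey R hR _ _ (hk.symm.trans hkl), ?_⟩
    rw [hq.decisionAt_nine hR hc, decisionAt_eq, hst, Option.bind_some, ho]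
    unfold NodeState.judge
    -- The reported identifier is the announced key if the node has an identifier itself, and `none`
    -- otherwise; `hid` says that either way this is `ids l`.
    rw [if_neg hne, dif_pos hbest, hkl, hid]

end Run

section Run

variable {n : ℕ} {ports : Ports n} {ids : Fin n → Option ℕ} {adv : Adversary n (coinCount n)}
  {ω : CoinSpace n (coinCount n)} {R t : ℕ} {v : Fin n} {st : NodeState n}

/-! ### Counting messages -/

/-- The number of referees that the coins of a node choose. -/
noncomputable def load (x : Fin (coinCount n) → Bool) : ℕ :=
  open Classical in (Finset.univ.filter fun p => Picks x p).card

/-- The load of those nodes in `F` whose coins satisfy `Q`. -/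
noncomputable def totalLoad (F : Finset (Fin n)) (Q : (Fin (coinCount n) → Bool) → Prop)
    (r : RoundCoins n (coinCount n)) : ℕ :=
  open Classical in ∑ v ∈ F, if Q (r v) then load (r v) else 0

/-- Every two nodes have a common referee. -/
def CommonReferees (ports : Ports n) (r : RoundCoins n (coinCount n)) : Prop :=
  ∀ u v, u ≠ v → ∃ (w : Fin n) (hu : w ≠ u) (hv : w ≠ v),
    Picks (r u) (portTo ports hu) ∧ Picks (r v) (portTo ports hv)

/-- The coins are such that the protocol sends few messages: in every round the possible candidates
send at most `n` requests, and sets of more than `m₁` or `m₂` nodes that were woken up together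
have a candidate. -/
structure Calm (ports : Ports n) (adv : Adversary n (coinCount n)) (m₁ m₂ : ℕ)
    (ω : CoinSpace n (coinCount n)) (t : ℕ) : Prop where
  load_rare : totalLoad Finset.univ Rare (ω t) ≤ n
  exists_rare : m₁ < (fresh adv ω t).card → ∃ v ∈ fresh adv ω t, Rare (ω t v)
  load_moderate : (fresh adv ω t).card ≤ m₁ → totalLoad (fresh adv ω t) Moderate (ω (t + 3)) ≤ n
  exists_moderate : m₂ < (fresh adv ω t).card → ∃ v ∈ fresh adv ω t, Moderate (ω (t + 3) v)
  load_all : (fresh adv ω t).card ≤ m₂ →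
    totalLoad (fresh adv ω t) (fun _ => True) (ω (t + 6)) ≤ n
  common : CommonReferees ports (ω t)

lemma card_filter_load (F : Finset (Fin n)) (Q : (Fin (coinCount n) → Bool) → Prop)
    (r : RoundCoins n (coinCount n)) [DecidablePred fun e : Fin n × Fin (n - 1) =>
      e.1 ∈ F ∧ Q (r e.1) ∧ Picks (r e.1) e.2] :
    (Finset.univ.filter fun e : Fin n × Fin (n - 1) =>
      e.1 ∈ F ∧ Q (r e.1) ∧ Picks (r e.1) e.2).card = totalLoad F Q r := by
  classical
  rw [Finset.card_filter, Fintype.sum_prod_type, totalLoad,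
    ← Finset.sum_subset (Finset.subset_univ F)]
  · refine Finset.sum_congr rfl fun v hv => ?_
    by_cases hQ : Q (r v) <;> simp [hv, hQ, load]
  · intro v _ hv
    simp [hv]

/-- The links that carry requests in round `t`. -/
def Asks (ports : Ports n) (ids : Fin n → Option ℕ) (adv : Adversary n (coinCount n))
    (ω : CoinSpace n (coinCount n)) (t : ℕ) (e : Fin n × Fin (n - 1)) : Prop :=
  Candidate ports ids adv ω t e.1 ∧ Picks (ω t e.1) e.2

lemma Quiet.card_asks_le {m₁ m₂ : ℕ} (hq : Quiet ports ids adv ω R)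
    (hcalm : ∀ t < 9, Calm ports adv m₁ m₂ ω t) (ht : t ≤ R + 2) (ht9 : t < 9)
    [DecidablePred (Asks ports ids adv ω t)] :
    (Finset.univ.filter (Asks ports ids adv ω t)).card ≤ 3 * n := by
  classical
  let S₁ := Finset.univ.filter fun e : Fin n × Fin (n - 1) =>
    e.1 ∈ (Finset.univ : Finset (Fin n)) ∧ Rare (ω t e.1) ∧ Picks (ω t e.1) e.2
  -- Subtraction is truncated, and before round 3 no clock shows 3.
  let F₂ := if 3 ≤ t then fresh adv ω (t - 3) else ∅
  let S₂ := Finset.univ.filter fun e : Fin n × Fin (n - 1) =>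
    e.1 ∈ F₂ ∧ Moderate (ω t e.1) ∧ Picks (ω t e.1) e.2
  let F₃ := if 6 ≤ t then fresh adv ω (t - 6) else ∅
  let S₃ := Finset.univ.filter fun e : Fin n × Fin (n - 1) =>
    e.1 ∈ F₃ ∧ True ∧ Picks (ω t e.1) e.2
  have hsub : Finset.univ.filter (Asks ports ids adv ω t) ⊆ S₁ ∪ (S₂ ∪ S₃) := by
    rintro ⟨v, p⟩ he
    obtain ⟨⟨st, hw, ho, hvol⟩, hp⟩ := (Finset.mem_filter.1 he).2
    have hs := (sound_woken hw).clock_le ho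
    simp only [S₁, S₂, S₃, Finset.mem_union, Finset.mem_filter, Finset.mem_univ, true_and]
    obtain ⟨-, h⟩ | ⟨hc, h⟩ | hc := hvol
    · exact .inl ⟨h, hp⟩
    · obtain ⟨h1, h2⟩ := hs _ hc
      refine .inr (.inl ⟨?_, h, hp⟩)
      simpa only [F₂, if_pos h1] using h2
    · obtain ⟨h1, h2⟩ := hs _ hc
      refine .inr (.inr ⟨?_, hp⟩)
      simpa only [F₃, if_pos h1] using h2
  have h1 : S₁.card ≤ n := by
    rw [card_filter_load]; exact (hcalm t ht9).load_rare
  have h2 : S₂.card ≤ n := by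
    rw [card_filter_load]
    by_cases h3 : 3 ≤ t
    · obtain ⟨s, rfl⟩ := Nat.exists_eq_add_of_le' h3
      simp only [F₂, if_pos h3, Nat.add_sub_cancel]
      have hs := hcalm s (by omega)
      apply hs.load_moderate
      -- Here `s + 3 ≤ R + 2`, so `s < R`. A large group woken in round `s` would have produced a
      -- candidate in that quiet round.
      by_contra hm
      obtain ⟨v, hv, hr⟩ := hs.exists_rare (not_le.1 hm)
      have hw := Quiet.woken_add (c := 0) (fun r hr => hq r (by omega)) hv
      exact hq s (by omega) v ⟨_, hw, rfl, .inl ⟨rfl, hr⟩⟩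
    · simp [F₂, if_neg h3, totalLoad]
  have h3 : S₃.card ≤ n := by
    have := card_filter_load F₃ (fun _ => True) (ω t)
    rw [this]
    by_cases h6 : 6 ≤ t
    · obtain ⟨s, rfl⟩ := Nat.exists_eq_add_of_le' h6
      simp only [F₃, if_pos h6, Nat.add_sub_cancel]
      have hs := hcalm s (by omega)
      apply hs.load_all
      -- Now `s + 6 ≤ R + 2`, so the second stage of the group, in round `s + 3`, is quiet as well.
      by_contra hm
      obtain ⟨v, hv, hr⟩ := hs.exists_moderate (not_le.1 hm)
      have hw := Quiet.woken_add (c := 3) (fun r hr => hq r (by omega)) hv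
      exact hq (s + 3) (by omega) v ⟨_, hw, rfl, .inr (.inl ⟨rfl, hr⟩)⟩
    · simp [F₃, if_neg h6, totalLoad]
  calc _ ≤ (S₁ ∪ (S₂ ∪ S₃)).card := Finset.card_le_card hsub
    _ ≤ S₁.card + (S₂ ∪ S₃).card := Finset.card_union_le _ _
    _ ≤ S₁.card + (S₂.card + S₃.card) := by gcongr; exact Finset.card_union_le _ _
    _ ≤ 3 * n := by omega

variable (ports ids adv ω t) in
/-- The number of messages sent in round `t`. -/
noncomputable def roundCount : ℕ :=
  ∑ v, ∑ p, if (msgs ports ids adv ω t v p).isSome then 1 else 0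

lemma roundCount_eq [DecidablePred fun e : Fin n × Fin (n - 1) =>
      msgs ports ids adv ω t e.1 e.2 ≠ none] :
    roundCount ports ids adv ω t = (Finset.univ.filter fun e : Fin n × Fin (n - 1) =>
      msgs ports ids adv ω t e.1 e.2 ≠ none).card := by
  rw [Finset.card_filter, Fintype.sum_prod_type, roundCount]
  refine Finset.sum_congr rfl fun v _ => Finset.sum_congr rfl fun p _ => ?_
  simp [Option.isSome_iff_ne_none]

lemma roundCount_le : roundCount ports ids adv ω t ≤ n * n := by
  classical
  rw [roundCount_eq]
  refine (Finset.card_le_univ _).trans ?_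
  rw [Fintype.card_prod, Fintype.card_fin, Fintype.card_fin]
  exact Nat.mul_le_mul_left _ (Nat.sub_le _ _)

/-- At most `3 * n` requests, `3 * n` refusals and `n` announcements: each refusal travels back
along the link of a request of the preceding round, and common referees leave at most one winner. -/
lemma Quiet.roundCount_le {m₁ m₂ : ℕ} (hq : Quiet ports ids adv ω R)
    (hcalm : ∀ t < 9, Calm ports adv m₁ m₂ ω t)
    (hkey : ∀ t < 9, ∀ u v, keyOf (ω t u) (ids u) = keyOf (ω t v) (ids v) → u = v)
    (hR : R ≤ 6) (ht : R ≤ t) (ht' : t < R + 3) : roundCount ports ids adv ω t ≤ 7 * n := by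
  classical
  rw [roundCount_eq]
  let A := Finset.univ.filter (Asks ports ids adv ω t)
  let B := Finset.univ.filter fun e : Fin n × Fin (n - 1) =>
    ∃ s, t = s + 1 ∧ Asks ports ids adv ω s (reverseEnd ports e)
  let W := Finset.univ.filter fun v => Winner ports ids adv ω R v
  have hsub : (Finset.univ.filter fun e : Fin n × Fin (n - 1) =>
      msgs ports ids adv ω t e.1 e.2 ≠ none) ⊆ A ∪ (B ∪ W ×ˢ Finset.univ) := by
    rintro ⟨v, p⟩ he
    simp only [A, B, W, Finset.mem_union, Finset.mem_filter, Finset.mem_univ, true_and,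
      Finset.mem_product, and_true]
    obtain h | ⟨s, hs, h⟩ | ⟨st, k, hw, hk, ho⟩ := msgs_classification (Finset.mem_filter.1 he).2
    · exact .inl h
    · exact .inr (.inl ⟨s, hs, h⟩)
    · right; right
      obtain rfl | rfl | rfl : t = R ∨ t = R + 1 ∨ t = R + 2 := by omega
      · obtain ⟨c, rfl⟩ := hq.woken_idle hw
        cases hk
      · by_cases hc : Candidate ports ids adv ω R v
        · rw [(hq.woken_succ hw).role_of_candidate hc] at hk; cases hk
        · rw [(hq.woken_succ hw).role_of_not hc] at hk; cases hk
      · exact (((hq.woken_add_two hw).role_eq k).1 hk).1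
  have hA : A.card ≤ 3 * n := hq.card_asks_le hcalm (by omega) (by omega)
  have hB : B.card ≤ 3 * n := by
    rcases t with _ | s
    · simp [B]
    · refine le_trans ?_ (hq.card_asks_le hcalm (t := s) (by omega) (by omega))
      apply Finset.card_le_card_of_injOn (reverseEnd ports)
      · intro e he
        obtain ⟨r, hr, h⟩ := (Finset.mem_filter.1 he).2
        obtain rfl : s = r := by omega
        exact Finset.mem_filter.2 ⟨Finset.mem_univ _, h⟩
      · intro e _ f _ hef
        rw [← reverseEnd_reverseEnd (ports := ports) e, hef, reverseEnd_reverseEnd]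
  have hW : W.card ≤ 1 := by
    rw [Finset.card_le_one]
    have key : ∀ u v, Winner ports ids adv ω R u → Winner ports ids adv ω R v →
        ¬ keyOf (ω R u) (ids u) < keyOf (ω R v) (ids v) := by
      intro u v hu hv hlt
      have huv : u ≠ v := by rintro rfl; exact lt_irrefl _ hlt
      obtain ⟨w, hwu, hwv, h1, h2⟩ := (hcalm R (by omega)).common u v huv
      exact hq.not_winner hwu hwv hu.1 hv.1 h1 h2 hlt hu
    intro u hu v hv
    have hu' := (Finset.mem_filter.1 hu).2
    have hv' := (Finset.mem_filter.1 hv).2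
    exact hkey R (by omega) u v (le_antisymm (not_lt.1 (key v u hv' hu'))
      (not_lt.1 (key u v hu' hv')))
  have hWn : (W ×ˢ (Finset.univ : Finset (Fin (n - 1)))).card ≤ n := by
    rw [Finset.card_product, Finset.card_univ, Fintype.card_fin]
    calc W.card * (n - 1) ≤ 1 * n := Nat.mul_le_mul hW (Nat.sub_le _ _)
      _ = n := one_mul n
  calc _ ≤ (A ∪ (B ∪ W ×ˢ Finset.univ)).card := Finset.card_le_card hsub
    _ ≤ A.card + (B ∪ W ×ˢ Finset.univ).card := Finset.card_union_le _ _
    _ ≤ A.card + (B.card + (W ×ˢ Finset.univ).card) := by gcongr; exact Finset.card_union_le _ _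
    _ ≤ 7 * n := by omega

/-- Messages occur only in the rounds `R`, `R + 1`, `R + 2`: before there is no candidate,
afterwards everybody has terminated. -/
lemma Quiet.messageCount_le (hq : Quiet ports ids adv ω R)
    (hc : ∃ v, Candidate ports ids adv ω R v) {M : ℕ}
    (hM : ∀ t, R ≤ t → t < R + 3 → roundCount ports ids adv ω t ≤ M) (T : ℕ) :
    messageCount (election n) ports ids adv ω T ≤ 3 * M := by
  classical
  change ∑ t ∈ Finset.range T, roundCount ports ids adv ω t ≤ 3 * M
  have h0 : ∀ t, t ∉ Finset.Ico R (R + 3) → roundCount ports ids adv ω t = 0 := by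
    intro t ht
    have : ∀ v p, msgs ports ids adv ω t v p = none := by
      intro v p
      rw [Finset.mem_Ico, not_and_or, not_le, not_lt] at ht
      obtain ht | ht := ht
      · exact Quiet.msgs_eq_none (fun s hs => hq s (by omega)) v p
      · exact hq.msgs_of_ge hc ht v p
    simp [roundCount, this]
  calc ∑ t ∈ Finset.range T, roundCount ports ids adv ω t
      = ∑ t ∈ Finset.range T ∩ Finset.Ico R (R + 3), roundCount ports ids adv ω t := by
        refine (Finset.sum_subset Finset.inter_subset_left fun t ht ht' => h0 t fun h => ?_).symm
        exact ht' (Finset.mem_inter.2 ⟨ht, h⟩)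
    _ ≤ ∑ t ∈ Finset.Ico R (R + 3), roundCount ports ids adv ω t :=
        Finset.sum_le_sum_of_subset Finset.inter_subset_right
    _ ≤ ∑ t ∈ Finset.Ico R (R + 3), M := Finset.sum_le_sum fun t ht =>
        hM t (Finset.mem_Ico.1 ht).1 (Finset.mem_Ico.1 ht).2
    _ = 3 * M := by simp

theorem messageCount_le_sq (T : ℕ) :
    messageCount (election n) ports ids adv ω T ≤ 3 * (n * n) := by
  obtain ⟨R, -, hq, hc⟩ := exists_candidate (ports := ports) (ids := ids) (adv := adv) (ω := ω)
  exact hq.messageCount_le hc (fun t _ _ => SyncElection.roundCount_le) T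

theorem messageCount_le_of_calm {m₁ m₂ : ℕ} (hcalm : ∀ t < 9, Calm ports adv m₁ m₂ ω t)
    (hkey : ∀ t < 9, ∀ u v, keyOf (ω t u) (ids u) = keyOf (ω t v) (ids v) → u = v) (T : ℕ) :
    messageCount (election n) ports ids adv ω T ≤ 21 * n := by
  obtain ⟨R, hR, hq, hc⟩ := exists_candidate (ports := ports) (ids := ids) (adv := adv) (ω := ω)
  have := hq.messageCount_le hc (fun t h1 h2 => hq.roundCount_le hcalm hkey hR h1 h2) T
  omega

/-! ### The size of the messages -/

lemma rank_lt (x : Fin (coinCount n) → Bool) : rank x < 2 ^ rankBits n := Nat.ofBits_lt_two_pow _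

lemma messageBitsLE_of_key_lt {b B : ℕ} (hB : ∀ t v, keyOf (ω t v) (ids v) < 2 ^ b)
    (h : 2 ≤ n → b + 2 ≤ B) : MessageBitsLE (election n) ports ids adv ω B := by
  intro t v p m hm
  -- A message needs a port, so `n ≥ 2` and `Nat.log 2 n ≥ 1`. This lets a multiple of the logarithm
  -- absorb additive constants.
  have hn : 2 ≤ n := by have := p.pos; omega
  have h1 : m ≤ 2 * 2 ^ b := msgs_le hB hm
  refine le_trans ?_ (h hn)
  rw [Nat.size_le]
  have : 0 < 2 ^ b := by positivity
  rw [pow_add]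
  omega

theorem messageBitsLE_anonymous :
    MessageBitsLE (election n) ports anonymous adv ω (10 * Nat.log 2 n) := by
  refine messageBitsLE_of_key_lt (b := rankBits n) (fun t v => rank_lt _) fun hn => ?_
  have : 1 ≤ Nat.log 2 n := Nat.log_pos one_lt_two hn
  simp only [rankBits]
  omega

theorem messageBitsLE_withIds {ident : Fin n → ℕ} {k : ℕ} (h : ∀ v, ident v ≤ n ^ k) :
    MessageBitsLE (election n) ports (withIds ident) adv ω ((2 * k + 3) * Nat.log 2 n) := by
  refine messageBitsLE_of_key_lt (b := (Nat.log 2 n + 1) * k + 1) (fun t v => ?_) fun hn => ?_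
  · change ident v < _
    refine (h v).trans_lt ?_
    calc n ^ k ≤ (2 ^ (Nat.log 2 n + 1)) ^ k :=
          Nat.pow_le_pow_left (Nat.lt_pow_succ_log_self one_lt_two n).le k
      _ = 2 ^ ((Nat.log 2 n + 1) * k) := (pow_mul _ _ _).symm
      _ < 2 ^ ((Nat.log 2 n + 1) * k + 1) := Nat.pow_lt_pow_right one_lt_two (Nat.lt_succ_self _)
  · have : 1 ≤ Nat.log 2 n := Nat.log_pos one_lt_two hn
    nlinarith

end Run

/-! ### Fair coins -/

section Coins

variable {n b : ℕ}

/-- One fair coin. -/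
noncomputable def fair : Measure Bool := (PMF.uniformOfFintype Bool).toMeasure

instance : IsProbabilityMeasure fair := by unfold fair; infer_instance

lemma fair_singleton (c : Bool) : fair {c} = 2⁻¹ := by
  simp [fair]

variable (n b) in
/-- The coins of one round. -/
noncomputable def roundMeasure : Measure (RoundCoins n b) :=
  (PMF.uniformOfFintype (RoundCoins n b)).toMeasure

instance : IsProbabilityMeasure (roundMeasure n b) := by unfold roundMeasure; infer_instance

instance : IsProbabilityMeasure (coinMeasure n b) := by unfold coinMeasure; infer_instance

lemma roundMeasure_singleton (r : RoundCoins n b) : roundMeasure n b {r} = 2⁻¹ ^ (n * b) := by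
  rw [roundMeasure, PMF.toMeasure_apply_singleton _ _ (measurableSet_singleton r)]
  simp [ENNReal.inv_pow, ← pow_mul, mul_comm]

lemma roundMeasure_eq_map : roundMeasure n b =
    (Measure.pi fun _ : Fin n × Fin b => fair).map fun x v i => x (v, i) := by
  have hm : Measurable fun (x : Fin n × Fin b → Bool) (v : Fin n) (i : Fin b) => x (v, i) := by
    fun_prop
  refine Measure.ext_of_singleton fun r => ?_
  rw [roundMeasure_singleton, Measure.map_apply hm (measurableSet_singleton r)]
  have : (fun (x : Fin n × Fin b → Bool) (v : Fin n) (i : Fin b) => x (v, i)) ⁻¹' {r} =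
      {fun j => r j.1 j.2} := by
    ext x
    simp only [Set.mem_preimage, Set.mem_singleton_iff]
    constructor
    · rintro rfl; rfl
    · rintro rfl; rfl
  rw [this, Measure.pi_singleton]
  simp [fair_singleton]

/-- Distinct coins show prescribed values with the expected probability. -/
lemma roundMeasure_forall_eq {ι : Type*} [Fintype ι] {f : ι → Fin n × Fin b}
    (hf : Function.Injective f) (g : ι → Bool) :
    roundMeasure n b {r | ∀ i, r (f i).1 (f i).2 = g i} = 2⁻¹ ^ Fintype.card ι := by
  classical
  have hm : Measurable fun (x : Fin n × Fin b → Bool) (v : Fin n) (i : Fin b) => x (v, i) := by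
    fun_prop
  rw [roundMeasure_eq_map, Measure.map_apply hm (Set.toFinite _).measurableSet]
  have : (fun (x : Fin n × Fin b → Bool) (v : Fin n) (i : Fin b) => x (v, i)) ⁻¹'
      {r | ∀ i, r (f i).1 (f i).2 = g i} =
      Set.univ.pi fun j => {c | ∀ i, f i = j → c = g i} := by
    ext x
    simp only [Set.mem_preimage, Set.mem_ofPred_eq, Set.mem_pi, Set.mem_univ, true_imp_iff,
      Prod.mk.eta]
    constructor
    · rintro h j i rfl; exact h i
    · intro h i; exact h _ i rfl
  rw [this, Measure.pi_pi]
  have h1 : ∀ j ∈ Finset.univ.image f, fair {c | ∀ i, f i = j → c = g i} = 2⁻¹ := by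
    intro j hj
    obtain ⟨i, -, rfl⟩ := Finset.mem_image.1 hj
    rw [← fair_singleton (g i)]
    congr 1
    ext c
    simp only [Set.mem_ofPred_eq, Set.mem_singleton_iff]
    constructor
    · intro h; exact h i rfl
    · rintro rfl k hk; rw [hf hk]
  rw [← Finset.prod_subset (Finset.subset_univ (Finset.univ.image f)), Finset.prod_congr rfl h1,
    Finset.prod_const, Finset.card_image_of_injective _ hf, Finset.card_univ]
  intro j _ hj
  have : {c | ∀ i, f i = j → c = g i} = Set.univ := by
    ext c
    simp only [Set.mem_ofPred_eq, Set.mem_univ, iff_true]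
    rintro i rfl
    exact absurd (Finset.mem_image_of_mem f (Finset.mem_univ i)) hj
  rw [this, measure_univ]

/-- Events that depend on disjoint blocks of coins are independent. -/
lemma roundMeasure_forall_block {W ι : Type*} [Fintype W] [Fintype ι] {f : W × ι → Fin n × Fin b}
    (hf : Function.Injective f) (Q : W → Set (ι → Bool)) :
    roundMeasure n b {r | ∀ w, (fun i => r (f (w, i)).1 (f (w, i)).2) ∈ Q w} =
      ∏ w, (Measure.pi fun _ : ι => fair) (Q w) := by
  classical
  have hm : Measurable fun (r : RoundCoins n b) (w : W) (i : ι) =>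
    r (f (w, i)).1 (f (w, i)).2 := by fun_prop
  have hmap : (roundMeasure n b).map (fun r w i => r (f (w, i)).1 (f (w, i)).2) =
      Measure.pi fun _ : W => Measure.pi fun _ : ι => fair := by
    refine Measure.ext_of_singleton fun y => ?_
    rw [Measure.map_apply hm (measurableSet_singleton y), Measure.pi_singleton]
    have : (fun (r : RoundCoins n b) (w : W) (i : ι) => r (f (w, i)).1 (f (w, i)).2) ⁻¹' {y} =
        {r | ∀ j, r (f j).1 (f j).2 = y j.1 j.2} := by
      ext r
      simp only [Set.mem_preimage, Set.mem_singleton_iff, Set.mem_ofPred_eq, Prod.forall,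
        funext_iff]
    rw [this, roundMeasure_forall_eq hf fun j => y j.1 j.2]
    simp only [Measure.pi_singleton, fair_singleton, Finset.prod_const, Finset.card_univ,
      Fintype.card_prod, ← pow_mul]
    rw [mul_comm]
  rw [← Measure.pi_pi, ← hmap, Measure.map_apply hm (Set.toFinite _).measurableSet]
  congr 1
  ext r
  simp

lemma pi_fair_not_all (ι : Type*) [Fintype ι] :
    (Measure.pi fun _ : ι => fair) {y | ¬ ∀ i, y i = true} = 1 - 2⁻¹ ^ Fintype.card ι := by
  classical
  have : {y : ι → Bool | ¬ ∀ i, y i = true} = {fun _ => true}ᶜ := by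
    ext y; simp [funext_iff]
  rw [this, prob_compl_eq_one_sub (measurableSet_singleton _), Measure.pi_singleton]
  simp [fair_singleton]

lemma pi_fair_eq : (Measure.pi fun _ : Bool => fair) {y | y false = y true} ≤ 2⁻¹ := by
  have : {y : Bool → Bool | y false = y true} ⊆ {fun _ => false} ∪ {fun _ => true} := by
    intro y hy
    simp only [Set.mem_ofPred_eq] at hy
    simp only [Set.mem_union, Set.mem_singleton_iff, funext_iff, Bool.forall_bool]
    rcases h : y true with _ | _ <;> simp [hy, h]
  refine (measure_mono this).trans ((measure_union_le _ _).trans ?_)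
  simp only [Measure.pi_singleton, fair_singleton, Finset.prod_const, Finset.card_univ,
    Fintype.card_bool]
  rw [← mul_two, pow_two, mul_assoc, ENNReal.inv_mul_cancel (by norm_num) (by norm_num), mul_one]

/-- With probability `1 - (1 - 2 ^ -k) ^ m`, one of `m` disjoint blocks of `k` coins shows only
`true`. -/
lemma roundMeasure_no_block {W ι : Type*} [Fintype W] [Fintype ι] {f : W × ι → Fin n × Fin b}
    (hf : Function.Injective f) :
    (roundMeasure n b).real {r | ∀ w, ¬ ∀ i, r (f (w, i)).1 (f (w, i)).2 = true} =
      (1 - 2⁻¹ ^ Fintype.card ι) ^ Fintype.card W := by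
  have h := roundMeasure_forall_block hf fun _ => {y | ¬ ∀ i, y i = true}
  simp only [Set.mem_ofPred_eq] at h
  rw [measureReal_def, h, pi_fair_not_all, Finset.prod_const, Finset.card_univ,
    ENNReal.toReal_pow, ENNReal.toReal_sub_of_le, ENNReal.toReal_pow]
  · simp
  · exact pow_le_one₀ (by simp) (by simp)
  · simp

/-! ### Conditioning on the coins of earlier rounds -/

lemma coinMeasure_history (s : ℕ) (h : Fin s → RoundCoins n b) (E : Set (RoundCoins n b)) :
    (coinMeasure n b) {ω | (fun i : Fin s => ω i) = h ∧ ω s ∈ E} =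
      (∏ i, roundMeasure n b {h i}) * roundMeasure n b E := by
  classical
  let A : ℕ → Set (RoundCoins n b) := fun i => if hi : i < s then {h ⟨i, hi⟩} else E
  have hset : {ω : CoinSpace n b | (fun i : Fin s => ω i) = h ∧ ω s ∈ E} =
      Set.pi (Finset.range (s + 1)) A := by
    ext ω
    simp only [Set.mem_ofPred_eq, Set.mem_pi, Finset.coe_range, Set.mem_Iio]
    constructor
    · rintro ⟨rfl, hE⟩ i hi
      by_cases his : i < s
      · simp [A, his]
      · obtain rfl : i = s := by omega
        simpa [A] using hE
    · intro hA
      refine ⟨?_, by simpa [A] using hA s (by omega)⟩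
      funext i
      simpa [A, i.2] using hA i (by omega)
  rw [hset, coinMeasure, Measure.infinitePi_pi _ fun i _ => (Set.toFinite _).measurableSet,
    Finset.prod_range_succ, Finset.prod_range]
  simp [A, roundMeasure]

/-- A bound for the coins of round `s` that holds whatever happened before. -/
lemma coinMeasure_le (s : ℕ) (E : (Fin s → RoundCoins n b) → Set (RoundCoins n b)) {δ : ℝ}
    (hE : ∀ h, (roundMeasure n b).real (E h) ≤ δ) :
    (coinMeasure n b).real {ω | ω s ∈ E fun i => ω i} ≤ δ := by
  classical
  -- There are finitely many histories. Given one, the event concerns only the fresh coins of round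
  -- `s`, and the probabilities of the histories sum to 1.
  have hsub : {ω : CoinSpace n b | ω s ∈ E fun i => ω i} ⊆
      ⋃ h : Fin s → RoundCoins n b, {ω | (fun i : Fin s => ω i) = h ∧ ω s ∈ E h} := by
    intro ω hω
    exact Set.mem_iUnion.2 ⟨_, rfl, hω⟩
  refine (measureReal_mono hsub (by finiteness)).trans ((measureReal_iUnion_fintype_le _).trans ?_)
  have h1 : ∀ h : Fin s → RoundCoins n b,
      (coinMeasure n b).real {ω | (fun i : Fin s => ω i) = h ∧ ω s ∈ E h} ≤
        (∏ i, (roundMeasure n b).real {h i}) * δ := by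
    intro h
    rw [measureReal_def, coinMeasure_history, ENNReal.toReal_mul, ENNReal.toReal_prod]
    exact mul_le_mul_of_nonneg_left (hE h) (Finset.prod_nonneg fun _ _ => ENNReal.toReal_nonneg)
  refine (Finset.sum_le_sum fun h _ => h1 h).trans ?_
  rw [← Finset.sum_mul, ← Fintype.piFinset_univ,
    ← Finset.prod_univ_sum (fun _ => Finset.univ) fun _ r => (roundMeasure n b).real {r}]
  have : ∑ r : RoundCoins n b, (roundMeasure n b).real {r} = 1 := by
    rw [sum_measureReal_singleton]
    simp
  simp [this]

end Coins

section Events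

variable {n : ℕ} {ports : Ports n} {adv : Adversary n (coinCount n)}

/-! ### The probabilities of bad coins -/

lemma coinAt_injective : Function.Injective (coinAt : CoinIndex n → Fin (coinCount n)) :=
  (Fintype.equivFin _).injective

/-- Markov's inequality at threshold `n`: the expected load is at most `F.card * n * q` by
linearity. -/
lemma roundMeasure_load_le {F : Finset (Fin n)} {Q : (Fin (coinCount n) → Bool) → Prop} {q : ℝ}
    (hq0 : 0 ≤ q) (hq : ∀ v p, (roundMeasure n (coinCount n)).real {r | Q (r v) ∧ Picks (r v) p} ≤ q) :
    (roundMeasure n (coinCount n)).real {r | n < totalLoad F Q r} ≤ F.card * q := by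
  classical
  rcases Nat.eq_zero_or_pos n with rfl | hn
  · have hF : F = ∅ := Finset.eq_empty_of_isEmpty F
    subst hF
    simp [totalLoad]
  have hload : ∀ r, (totalLoad F Q r : ℝ) =
      ∑ v ∈ F, ∑ p, Set.indicator {r | Q (r v) ∧ Picks (r v) p} (fun _ => (1 : ℝ)) r := by
    intro r
    rw [totalLoad, Nat.cast_sum]
    refine Finset.sum_congr rfl fun v _ => ?_
    by_cases hQ : Q (r v) <;> simp [hQ, load, Set.indicator_apply]
  have hint : ∫ r, (totalLoad F Q r : ℝ) ∂(roundMeasure n (coinCount n)) ≤ n * (F.card * q) := by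
    simp only [hload]
    rw [integral_finsetSum _ fun _ _ => Integrable.of_finite]
    calc _ ≤ ∑ v ∈ F, ∑ p : Fin (n - 1), q := by
          refine Finset.sum_le_sum fun v _ => ?_
          rw [integral_finsetSum _ fun _ _ => Integrable.of_finite]
          refine Finset.sum_le_sum fun p _ => ?_
          rw [integral_indicator (Set.toFinite _).measurableSet]
          simpa using hq v p
      _ = F.card * ((n - 1 : ℕ) * q) := by simp
      _ ≤ F.card * (n * q) := by gcongr; omega
      _ = n * (F.card * q) := by ring
  have hmarkov := mul_meas_ge_le_integral_of_nonneg (μ := roundMeasure n (coinCount n))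
    (f := fun r => (totalLoad F Q r : ℝ)) (Filter.Eventually.of_forall fun r => by positivity)
    Integrable.of_finite n
  have hmono : (roundMeasure n (coinCount n)).real {r | n < totalLoad F Q r} ≤
      (roundMeasure n (coinCount n)).real {r | (n : ℝ) ≤ totalLoad F Q r} := by
    refine measureReal_mono (fun r hr => ?_)
    have : n < totalLoad F Q r := hr
    exact_mod_cast this.le
  have hn' : (0 : ℝ) < n := by exact_mod_cast hn
  refine hmono.trans (le_of_mul_le_mul_left (hmarkov.trans hint) hn')

/-- The probability that certain coins of one node show `true`. -/
lemma roundMeasure_coins {ι : Type*} [Fintype ι] {g : ι → CoinIndex n}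
    (hg : Function.Injective g) (v : Fin n) :
    (roundMeasure n (coinCount n)).real {r | ∀ i, r v (coinAt (g i)) = true} =
      2⁻¹ ^ Fintype.card ι := by
  have hf : Function.Injective fun i => (v, coinAt (g i)) := fun i j h =>
    hg (coinAt_injective (Prod.ext_iff.1 h).2)
  rw [measureReal_def, roundMeasure_forall_eq hf fun _ => true]
  simp

variable (n) in
/-- The probabilities are powers of this number. -/
noncomputable def base : ℝ := 2 ^ scale n

lemma inv_two_pow_mul (k : ℕ) : (2⁻¹ : ℝ) ^ (k * scale n) = (base n)⁻¹ ^ k := by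
  rw [base, ← inv_pow, ← pow_mul, mul_comm]

lemma one_le_base : 1 ≤ base n := one_le_pow₀ one_le_two

lemma roundMeasure_rare_picks (v : Fin n) (p : Fin (n - 1)) :
    (roundMeasure n (coinCount n)).real {r | Rare (r v) ∧ Picks (r v) p} = (base n)⁻¹ ^ 17 := by
  have h := roundMeasure_coins (n := n) (ι := Fin (10 * scale n) ⊕ Fin (7 * scale n))
    (g := Sum.elim (fun i => .inl (.inl i)) fun i => .inr (.inl (p, i)))
    (by rintro (i | i) (j | j) h <;> simp_all) v
  simp only [Sum.forall, Sum.elim_inl, Sum.elim_inr, Fintype.card_sum, Fintype.card_fin] at h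
  rw [← inv_two_pow_mul, show 17 * scale n = 10 * scale n + 7 * scale n by ring, ← h]
  rfl

lemma roundMeasure_moderate_picks (v : Fin n) (p : Fin (n - 1)) :
    (roundMeasure n (coinCount n)).real {r | Moderate (r v) ∧ Picks (r v) p} =
      (base n)⁻¹ ^ 12 := by
  have h := roundMeasure_coins (n := n) (ι := Fin (5 * scale n) ⊕ Fin (7 * scale n))
    (g := Sum.elim (fun i => .inl (.inr i)) fun i => .inr (.inl (p, i)))
    (by rintro (i | i) (j | j) h <;> simp_all) v
  simp only [Sum.forall, Sum.elim_inl, Sum.elim_inr, Fintype.card_sum, Fintype.card_fin] at h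
  rw [← inv_two_pow_mul, show 12 * scale n = 5 * scale n + 7 * scale n by ring, ← h]
  rfl

lemma roundMeasure_picks (v : Fin n) (p : Fin (n - 1)) :
    (roundMeasure n (coinCount n)).real {r | True ∧ Picks (r v) p} = (base n)⁻¹ ^ 7 := by
  have h := roundMeasure_coins (n := n) (ι := Fin (7 * scale n))
    (g := fun i => .inr (.inl (p, i))) (fun i j h => by simpa using h) v
  rw [Fintype.card_fin, inv_two_pow_mul] at h
  simp only [true_and]
  exact h

/-- The probability that no node of `F` has only `true` among certain coins. -/
lemma roundMeasure_none {ι : Type*} [Fintype ι] {g : ι → CoinIndex n}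
    (hg : Function.Injective g) (F : Finset (Fin n)) :
    (roundMeasure n (coinCount n)).real {r | ∀ v ∈ F, ¬ ∀ i, r v (coinAt (g i)) = true} =
      (1 - 2⁻¹ ^ Fintype.card ι) ^ F.card := by
  have hf : Function.Injective fun j : F × ι => ((j.1 : Fin n), coinAt (g j.2)) := by
    rintro ⟨u, i⟩ ⟨v, j⟩ h
    obtain ⟨h1, h2⟩ := Prod.ext_iff.1 h
    exact Prod.ext (Subtype.ext h1) (hg (coinAt_injective h2))
  rw [← Fintype.card_coe F, ← roundMeasure_no_block hf]
  simp

lemma roundMeasure_no_rare (F : Finset (Fin n)) :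
    (roundMeasure n (coinCount n)).real {r | ∀ v ∈ F, ¬ Rare (r v)} =
      (1 - (base n)⁻¹ ^ 10) ^ F.card := by
  have h := roundMeasure_none (n := n) (ι := Fin (10 * scale n)) (g := fun i => .inl (.inl i))
    (fun i j h => by simpa using h) F
  rwa [Fintype.card_fin, inv_two_pow_mul] at h

lemma roundMeasure_no_moderate (F : Finset (Fin n)) :
    (roundMeasure n (coinCount n)).real {r | ∀ v ∈ F, ¬ Moderate (r v)} =
      (1 - (base n)⁻¹ ^ 5) ^ F.card := by
  have h := roundMeasure_none (n := n) (ι := Fin (5 * scale n)) (g := fun i => .inl (.inr i))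
    (fun i j h => by simpa using h) F
  rwa [Fintype.card_fin, inv_two_pow_mul] at h

lemma portTo_injective {u w w' : Fin n} {h : w ≠ u} {h' : w' ≠ u}
    (he : portTo ports h = portTo ports h') : w = w' := by
  rw [← ports_portTo (ports := ports) h, he, ports_portTo]

/-- Each of the `n - 2` other nodes `w` owns a block of `14 * scale n` coins: those of `u` and those
of `v` for their ports to `w`. The blocks are disjoint, so the events are independent. -/
lemma roundMeasure_no_common {u v : Fin n} (huv : u ≠ v) :
    (roundMeasure n (coinCount n)).real {r | ∀ (w : Fin n) (hu : w ≠ u) (hv : w ≠ v),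
      ¬ (Picks (r u) (portTo ports hu) ∧ Picks (r v) (portTo ports hv))} =
      (1 - (base n)⁻¹ ^ 14) ^ (n - 2) := by
  classical
  let W := {w : Fin n // w ≠ u ∧ w ≠ v}
  let f : W × (Fin (7 * scale n) ⊕ Fin (7 * scale n)) → Fin n × Fin (coinCount n) := fun j =>
    Sum.elim (fun i => (u, coinAt (.inr (.inl (portTo ports j.1.2.1, i)))))
      (fun i => (v, coinAt (.inr (.inl (portTo ports j.1.2.2, i))))) j.2
  have hf : Function.Injective f := by
    rintro ⟨⟨w, hw⟩, i | i⟩ ⟨⟨w', hw'⟩, j | j⟩ h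
    · have h2 := coinAt_injective (Prod.ext_iff.1 h).2
      simp only [Sum.inr.injEq, Sum.inl.injEq, Prod.mk.injEq] at h2
      obtain rfl := portTo_injective h2.1
      rw [h2.2]
    · exact absurd (Prod.ext_iff.1 h).1 huv
    · exact absurd (Prod.ext_iff.1 h).1 huv.symm
    · have h2 := coinAt_injective (Prod.ext_iff.1 h).2
      simp only [Sum.inr.injEq, Sum.inl.injEq, Prod.mk.injEq] at h2
      obtain rfl := portTo_injective h2.1
      rw [h2.2]
  have hW : Fintype.card W = n - 2 := by
    have : Fintype.card W = (Finset.univ \ {u, v} : Finset (Fin n)).card := by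
      rw [Fintype.card_subtype]
      congr 1
      ext w
      simp
    rw [this, Finset.card_univ_sdiff, Fintype.card_fin, Finset.card_pair huv]
  have h := roundMeasure_no_block hf
  rw [hW, Fintype.card_sum, Fintype.card_fin, ← two_mul, ← mul_assoc, inv_two_pow_mul,
    show 2 * 7 = 14 from rfl] at h
  rw [← h]
  congr 1
  ext r
  simp only [Set.mem_ofPred_eq, Sum.forall, Subtype.forall, W, f, Sum.elim_inl, Sum.elim_inr]
  exact ⟨fun h w hw => h w hw.1 hw.2, fun h w hu hv => h w ⟨hu, hv⟩⟩

lemma roundMeasure_rank_eq {u v : Fin n} (huv : u ≠ v) :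
    (roundMeasure n (coinCount n)).real {r | rank (r u) = rank (r v)} ≤ 2⁻¹ ^ rankBits n := by
  -- Block `i` consists of the `i`-th rank bits of the two nodes, which agree with probability 1/2.
  let f : Fin (rankBits n) × Bool → Fin n × Fin (coinCount n) := fun j =>
    (if j.2 then u else v, coinAt (.inr (.inr j.1)))
  have hf : Function.Injective f := by
    rintro ⟨i, c⟩ ⟨j, d⟩ h
    obtain ⟨h1, h2⟩ := Prod.ext_iff.1 h
    have h3 := coinAt_injective h2
    simp only [Sum.inr.injEq] at h3
    subst h3
    have h4 : (if c then u else v) = if d then u else v := h1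
    rcases c with _ | _ <;> rcases d with _ | _ <;> simp_all [huv.symm]
  have hsub : {r : RoundCoins n (coinCount n) | rank (r u) = rank (r v)} ⊆
      {r | ∀ w, (fun i => r (f (w, i)).1 (f (w, i)).2) ∈ {y : Bool → Bool | y false = y true}} := by
    intro r hr w
    have h1 : rank (r u) = rank (r v) := hr
    have h2 := congrArg (fun m => m.testBit w) h1
    simp only [rank, Nat.testBit_ofBits_lt _ _ w.2] at h2
    simpa [f] using h2.symm
  refine (measureReal_mono hsub).trans ?_
  rw [measureReal_def, roundMeasure_forall_block hf fun _ => {y | y false = y true},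
    Finset.prod_const, Finset.card_univ, Fintype.card_fin, ENNReal.toReal_pow]
  gcongr
  refine (ENNReal.toReal_mono (by simp) pi_fair_eq).trans ?_
  simp

/-- A bound for the coins of round `s` in relation to the nodes woken up in round `t ≤ s`. -/
lemma coinMeasure_fresh_le {s t : ℕ} (hts : t ≤ s)
    (E : Finset (Fin n) → Set (RoundCoins n (coinCount n))) {δ : ℝ}
    (hE : ∀ F, (roundMeasure n (coinCount n)).real (E F) ≤ δ) :
    (coinMeasure n (coinCount n)).real {ω | ω s ∈ E (fresh adv ω t)} ≤ δ := by
  -- The default coins from round `s` on are irrelevant, because `fresh adv · t` reads only rounds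
  -- before `t ≤ s`.
  let extend : (Fin s → RoundCoins n (coinCount n)) → CoinSpace n (coinCount n) := fun h i =>
    if hi : i < s then h ⟨i, hi⟩ else fun _ _ => false
  have := coinMeasure_le s (fun h => E (fresh adv (extend h) t)) fun h => hE _
  convert this using 5 with ω
  refine congrArg E (fresh_congr fun i hi => ?_)
  simp [extend, show i < s by omega]

end Events

section Bounds

variable {n : ℕ} {ports : Ports n} {adv : Adversary n (coinCount n)}

/-! ### Estimates in powers of `base n` -/

lemma base_pow_le (hn : 0 < n) : base n ^ 16 ≤ n := by
  have h : (2 ^ scale n) ^ 16 ≤ n := by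
    rw [← pow_mul]
    exact (Nat.pow_le_pow_right two_pos (Nat.div_mul_le_self _ _)).trans
      (Nat.pow_log_le_self 2 hn.ne')
  have h' : (((2 ^ scale n) ^ 16 : ℕ) : ℝ) ≤ n := by exact_mod_cast h
  simpa [base] using h'

lemma lt_two_mul_base_pow : (n : ℝ) < (2 * base n) ^ 16 := by
  have h : n < (2 * 2 ^ scale n) ^ 16 := by
    refine (Nat.lt_pow_succ_log_self one_lt_two n).trans_le ?_
    rw [← pow_succ', ← pow_mul]
    refine Nat.pow_le_pow_right two_pos ?_
    have := Nat.lt_div_mul_add (a := Nat.log 2 n) (b := 16) (by norm_num)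
    simp only [scale]
    omega
  have h' : (n : ℝ) < (((2 * 2 ^ scale n) ^ 16 : ℕ) : ℝ) := by exact_mod_cast h
  simpa [base] using h'

lemma one_sub_pow_le {y : ℝ} (h1 : y ≤ 1) (m : ℕ) : (1 - y) ^ m ≤ Real.exp (-(m * y)) := by
  calc (1 - y) ^ m ≤ Real.exp (-y) ^ m :=
        pow_le_pow_left₀ (by linarith) (Real.one_sub_le_exp_neg y) m
    _ = Real.exp (-(m * y)) := by rw [← Real.exp_nat_mul]; ring_nf

lemma exp_neg_base_le : Real.exp (-base n) ≤ (base n)⁻¹ := by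
  have h0 : 0 < base n := one_pos.trans_le one_le_base
  rw [Real.exp_neg]
  exact inv_anti₀ h0 (by linarith [Real.add_one_le_exp (base n)])

/-- One power of `base n` more nodes than the inverse success probability bounds the probability
that all fail by `exp (-base n)`. -/
lemma one_sub_base_pow_le {j k m : ℕ} (hk : k = j + 1) (hm : 2 ^ (k * scale n) ≤ m) :
    (1 - (base n)⁻¹ ^ j) ^ m ≤ (base n)⁻¹ := by
  have h0 : 0 < base n := one_pos.trans_le one_le_base
  refine (one_sub_pow_le (pow_le_one₀ (by positivity) (inv_le_one_of_one_le₀ one_le_base)) m).trans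
    (le_trans (Real.exp_le_exp.2 ?_) exp_neg_base_le)
  have h1 : base n ^ k ≤ m := by
    have : ((2 ^ (k * scale n) : ℕ) : ℝ) ≤ m := by exact_mod_cast hm
    rw [base, ← pow_mul, mul_comm]
    simpa using this
  have h2 : base n = base n ^ k * (base n)⁻¹ ^ j := by
    rw [hk, inv_pow]; field_simp; ring
  have h3 : base n ≤ m * (base n)⁻¹ ^ j :=
    h2.le.trans (mul_le_mul_of_nonneg_right h1 (by positivity))
  linarith

lemma card_mul_base_le {F : Finset (Fin n)} {j k : ℕ} (hk : k = j + 1)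
    (hF : F.card ≤ 2 ^ (j * scale n)) : F.card * (base n)⁻¹ ^ k ≤ (base n)⁻¹ := by
  have h0 : 0 < base n := one_pos.trans_le one_le_base
  have h1 : (F.card : ℝ) ≤ base n ^ j := by
    have : (F.card : ℝ) ≤ ((2 ^ (j * scale n) : ℕ) : ℝ) := by exact_mod_cast hF
    rw [base, ← pow_mul, mul_comm]
    simpa using this
  calc F.card * (base n)⁻¹ ^ k ≤ base n ^ j * (base n)⁻¹ ^ k := by gcongr
    _ = (base n)⁻¹ := by rw [hk, inv_pow]; field_simp; ring

/-- The constant that bounds the probability of having no common referees. -/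
def refereeConst : ℕ := 2 ^ 49 * Nat.factorial 17

lemma no_common_le (hn : 4 ≤ n) :
    (n : ℝ) ^ 2 * (1 - (base n)⁻¹ ^ 14) ^ (n - 2) ≤ refereeConst * (base n)⁻¹ := by
  have h1 : 1 ≤ base n := one_le_base
  have h0 : 0 < base n := one_pos.trans_le h1
  have hz : (base n)⁻¹ ^ 14 ≤ 1 := pow_le_one₀ (by positivity) (inv_le_one_of_one_le₀ h1)
  have hy : base n ^ 2 / 2 ≤ (n - 2 : ℕ) * (base n)⁻¹ ^ 14 := by
    have h2 : base n ^ 16 / 2 ≤ (n - 2 : ℕ) := by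
      have := base_pow_le (n := n) (by omega)
      rw [Nat.cast_sub (by omega)]
      have h4 : (4 : ℝ) ≤ n := by exact_mod_cast hn
      push_cast
      linarith
    calc base n ^ 2 / 2 = base n ^ 16 / 2 * (base n)⁻¹ ^ 14 := by rw [inv_pow]; field_simp
      _ ≤ _ := by gcongr
  have h3 : (1 - (base n)⁻¹ ^ 14) ^ (n - 2) ≤ Real.exp (-(base n ^ 2 / 2)) :=
    (one_sub_pow_le hz _).trans (Real.exp_le_exp.2 (by linarith))
  -- The factor `n ^ 2` for the pairs costs up to `(2 * base n) ^ 32`. The exponent 17 gives `base n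
  -- ^ 34` in the denominator, enough to leave a factor `(base n)⁻¹`.
  have h4 : Real.exp (-(base n ^ 2 / 2)) ≤ (Nat.factorial 17 : ℝ) / (base n ^ 2 / 2) ^ 17 := by
    rw [Real.exp_neg, ← inv_div ((base n ^ 2 / 2) ^ 17) (Nat.factorial 17 : ℝ)]
    exact inv_anti₀ (by positivity) (Real.pow_div_factorial_le_exp _ (by positivity) 17)
  have h5 : (n : ℝ) ^ 2 ≤ ((2 * base n) ^ 16) ^ 2 := by
    gcongr
    exact lt_two_mul_base_pow.le
  calc (n : ℝ) ^ 2 * (1 - (base n)⁻¹ ^ 14) ^ (n - 2)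
      ≤ ((2 * base n) ^ 16) ^ 2 * ((Nat.factorial 17 : ℝ) / (base n ^ 2 / 2) ^ 17) :=
        mul_le_mul h5 (h3.trans h4) (pow_nonneg (sub_nonneg.2 hz) _) (by positivity)
    _ = (2 ^ 49 * Nat.factorial 17) * ((base n)⁻¹ * (base n)⁻¹) := by
        field_simp
    _ ≤ (2 ^ 49 * Nat.factorial 17) * ((base n)⁻¹ * 1) := by
        gcongr
        exact inv_le_one_of_one_le₀ h1
    _ = refereeConst * (base n)⁻¹ := by rw [refereeConst]; push_cast; ring

/-! ### Union bounds over the bad events -/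

lemma measureReal_exists_pair_le {Ω : Type*} [MeasurableSpace Ω] (μ : Measure Ω)
    [IsFiniteMeasure μ] (E : Fin n → Fin n → Set Ω) {δ : ℝ} (hδ : 0 ≤ δ)
    (h : ∀ u v, u ≠ v → μ.real (E u v) ≤ δ) :
    μ.real {x | ∃ u v, u ≠ v ∧ x ∈ E u v} ≤ n ^ 2 * δ := by
  classical
  rcases Nat.lt_or_ge n 2 with hn | hn
  · have : {x | ∃ u v, u ≠ v ∧ x ∈ E u v} = ∅ := by
      ext x
      simp only [Set.mem_ofPred_eq, Set.mem_empty_iff_false, iff_false]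
      rintro ⟨u, v, huv, -⟩
      exact huv (Fin.ext (by omega))
    rw [this, measureReal_empty]
    positivity
  have hsub : {x | ∃ u v, u ≠ v ∧ x ∈ E u v} ⊆
      ⋃ j : Fin n × Fin n, if j.1 = j.2 then ∅ else E j.1 j.2 := by
    rintro x ⟨u, v, huv, hx⟩
    exact Set.mem_iUnion.2 ⟨(u, v), by simpa [huv] using hx⟩
  refine (measureReal_mono hsub (by finiteness)).trans ((measureReal_iUnion_fintype_le _).trans ?_)
  calc _ ≤ ∑ j : Fin n × Fin n, δ := by
        refine Finset.sum_le_sum fun j _ => ?_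
        split_ifs with hj
        · simpa using hδ
        · exact h _ _ hj
    _ = n ^ 2 * δ := by simp [pow_two]

/-- The coins of a round are calm with high probability. -/
lemma coinMeasure_not_calm_le (hn : 4 ≤ n) (t : ℕ) :
    (coinMeasure n (coinCount n)).real
      {ω | ¬ Calm ports adv (2 ^ (11 * scale n)) (2 ^ (6 * scale n)) ω t} ≤
      (2 ^ 16 + 4 + refereeConst : ℕ) * (base n)⁻¹ := by
  classical
  have h0 : 0 < base n := one_pos.trans_le one_le_base
  let E₁ : Set (CoinSpace n (coinCount n)) := {ω | n < totalLoad Finset.univ Rare (ω t)}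
  let E₂ : Set (CoinSpace n (coinCount n)) :=
    {ω | 2 ^ (11 * scale n) < (fresh adv ω t).card ∧ ∀ v ∈ fresh adv ω t, ¬ Rare (ω t v)}
  let E₃ : Set (CoinSpace n (coinCount n)) :=
    {ω | (fresh adv ω t).card ≤ 2 ^ (11 * scale n) ∧ n < totalLoad (fresh adv ω t) Moderate (ω (t + 3))}
  let E₄ : Set (CoinSpace n (coinCount n)) :=
    {ω | 2 ^ (6 * scale n) < (fresh adv ω t).card ∧ ∀ v ∈ fresh adv ω t, ¬ Moderate (ω (t + 3) v)}
  let E₅ : Set (CoinSpace n (coinCount n)) :=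
    {ω | (fresh adv ω t).card ≤ 2 ^ (6 * scale n) ∧
      n < totalLoad (fresh adv ω t) (fun _ => True) (ω (t + 6))}
  let E₆ : Set (CoinSpace n (coinCount n)) :=
    {ω | ∃ u v, u ≠ v ∧ ω t ∈ {r : RoundCoins n (coinCount n) |
      ∀ (w : Fin n) (hu : w ≠ u) (hv : w ≠ v),
        ¬ (Picks (r u) (portTo ports hu) ∧ Picks (r v) (portTo ports hv))}}
  have hsub : {ω | ¬ Calm ports adv (2 ^ (11 * scale n)) (2 ^ (6 * scale n)) ω t} ⊆
      E₁ ∪ (E₂ ∪ (E₃ ∪ (E₄ ∪ (E₅ ∪ E₆)))) := by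
    intro ω hω
    by_contra hcon
    simp only [Set.mem_union, not_or] at hcon
    obtain ⟨h1, h2, h3, h4, h5, h6⟩ := hcon
    refine hω ⟨not_lt.1 h1, fun h => ?_, fun h => ?_, fun h => ?_, fun h => ?_, fun u v huv => ?_⟩
    · by_contra hc; push Not at hc; exact h2 ⟨h, hc⟩
    · by_contra hc; exact h3 ⟨h, not_le.1 hc⟩
    · by_contra hc; push Not at hc; exact h4 ⟨h, hc⟩
    · by_contra hc; exact h5 ⟨h, not_le.1 hc⟩
    · by_contra hc
      refine h6 ⟨u, v, huv, fun w hu hv hp => hc ⟨w, hu, hv, hp⟩⟩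
  -- All `n` nodes are counted here, and `n` is bounded only by `(2 * base n) ^ 16`; hence the
  -- constant `2 ^ 16`.
  have b1 : (coinMeasure n (coinCount n)).real E₁ ≤ 2 ^ 16 * (base n)⁻¹ := by
    refine (coinMeasure_le t (fun _ => {r | n < totalLoad Finset.univ Rare r}) fun _ =>
      roundMeasure_load_le (by positivity) fun v p => (roundMeasure_rare_picks v p).le).trans ?_
    rw [Finset.card_univ, Fintype.card_fin]
    calc n * (base n)⁻¹ ^ 17 ≤ (2 * base n) ^ 16 * (base n)⁻¹ ^ 17 := by
          gcongr; exact lt_two_mul_base_pow.le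
      _ = 2 ^ 16 * (base n)⁻¹ := by rw [inv_pow]; field_simp
  have b2 : (coinMeasure n (coinCount n)).real E₂ ≤ (base n)⁻¹ := by
    refine coinMeasure_fresh_le le_rfl (fun F => {r | 2 ^ (11 * scale n) < F.card ∧ ∀ v ∈ F, ¬ Rare (r v)})
      fun F => ?_
    by_cases hF : 2 ^ (11 * scale n) < F.card
    · simp only [hF, true_and, roundMeasure_no_rare]
      exact one_sub_base_pow_le (k := 11) rfl hF.le
    · simp only [hF, false_and]
      simpa using h0.le
  have b3 : (coinMeasure n (coinCount n)).real E₃ ≤ (base n)⁻¹ := by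
    refine coinMeasure_fresh_le (Nat.le_add_right t 3)
      (fun F => {r | F.card ≤ 2 ^ (11 * scale n) ∧ n < totalLoad F Moderate r}) fun F => ?_
    by_cases hF : F.card ≤ 2 ^ (11 * scale n)
    · simp only [hF, true_and]
      have := roundMeasure_load_le (F := F) (Q := Moderate) (q := (base n)⁻¹ ^ 12)
        (by positivity) fun v p => (roundMeasure_moderate_picks v p).le
      exact this.trans (card_mul_base_le rfl hF)
    · simp only [hF, false_and]
      simpa using h0.le
  have b4 : (coinMeasure n (coinCount n)).real E₄ ≤ (base n)⁻¹ := by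
    refine coinMeasure_fresh_le (Nat.le_add_right t 3)
      (fun F => {r | 2 ^ (6 * scale n) < F.card ∧ ∀ v ∈ F, ¬ Moderate (r v)}) fun F => ?_
    by_cases hF : 2 ^ (6 * scale n) < F.card
    · simp only [hF, true_and, roundMeasure_no_moderate]
      exact one_sub_base_pow_le (k := 6) rfl hF.le
    · simp only [hF, false_and]
      simpa using h0.le
  have b5 : (coinMeasure n (coinCount n)).real E₅ ≤ (base n)⁻¹ := by
    refine coinMeasure_fresh_le (Nat.le_add_right t 6)
      (fun F => {r | F.card ≤ 2 ^ (6 * scale n) ∧ n < totalLoad F (fun _ => True) r}) fun F => ?_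
    by_cases hF : F.card ≤ 2 ^ (6 * scale n)
    · simp only [hF, true_and]
      have := roundMeasure_load_le (F := F) (Q := fun _ => True) (q := (base n)⁻¹ ^ 7)
        (by positivity) fun v p => (roundMeasure_picks v p).le
      exact this.trans (card_mul_base_le rfl hF)
    · simp only [hF, false_and]
      simpa using h0.le
  have b6 : (coinMeasure n (coinCount n)).real E₆ ≤ refereeConst * (base n)⁻¹ := by
    refine le_trans (measureReal_exists_pair_le _ _ (pow_nonneg (sub_nonneg.2
      (pow_le_one₀ (by positivity) (inv_le_one_of_one_le₀ one_le_base))) _) fun u v huv => ?_)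
      (no_common_le hn)
    exact coinMeasure_le t (fun _ => {r : RoundCoins n (coinCount n) |
      ∀ (w : Fin n) (hu : w ≠ u) (hv : w ≠ v),
        ¬ (Picks (r u) (portTo ports hu) ∧ Picks (r v) (portTo ports hv))}) fun _ =>
      (roundMeasure_no_common huv).le
  refine (measureReal_mono hsub (by finiteness)).trans ?_
  have u1 := measureReal_union_le (μ := coinMeasure n (coinCount n)) E₁
    (E₂ ∪ (E₃ ∪ (E₄ ∪ (E₅ ∪ E₆))))
  have u2 := measureReal_union_le (μ := coinMeasure n (coinCount n)) E₂ (E₃ ∪ (E₄ ∪ (E₅ ∪ E₆)))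
  have u3 := measureReal_union_le (μ := coinMeasure n (coinCount n)) E₃ (E₄ ∪ (E₅ ∪ E₆))
  have u4 := measureReal_union_le (μ := coinMeasure n (coinCount n)) E₄ (E₅ ∪ E₆)
  have u5 := measureReal_union_le (μ := coinMeasure n (coinCount n)) E₅ E₆
  push_cast
  linarith

lemma coinMeasure_exists_lt_nine_le {b : ℕ} (E : ℕ → Set (CoinSpace n b)) {δ : ℝ}
    (h : ∀ t, (coinMeasure n b).real (E t) ≤ δ) :
    (coinMeasure n b).real {ω | ∃ t < 9, ω ∈ E t} ≤ 9 * δ := by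
  have hsub : {ω | ∃ t < 9, ω ∈ E t} ⊆ ⋃ t : Fin 9, E t := by
    rintro ω ⟨t, ht, hω⟩
    exact Set.mem_iUnion.2 ⟨⟨t, ht⟩, hω⟩
  refine (measureReal_mono hsub (by finiteness)).trans ((measureReal_iUnion_fintype_le _).trans ?_)
  calc _ ≤ ∑ _ : Fin 9, δ := Finset.sum_le_sum fun t _ => h t
    _ = 9 * δ := by simp

/-- The random ranks are pairwise distinct with high probability. -/
lemma coinMeasure_rank_eq_le (hn : 0 < n) :
    (coinMeasure n (coinCount n)).real
      {ω | ∃ t < 9, ∃ u v, u ≠ v ∧ rank (ω t u) = rank (ω t v)} ≤ (n : ℝ)⁻¹ := by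
  have h1 : (coinMeasure n (coinCount n)).real
      {ω | ∃ t < 9, ∃ u v, u ≠ v ∧ rank (ω t u) = rank (ω t v)} ≤
      9 * (n ^ 2 * 2⁻¹ ^ rankBits n) := by
    refine coinMeasure_exists_lt_nine_le
      (fun t => {ω | ∃ u v, u ≠ v ∧ ω ∈ {ω | rank (ω t u) = rank (ω t v)}}) fun t => ?_
    refine measureReal_exists_pair_le _ _ (by positivity) fun u v huv => ?_
    exact coinMeasure_le t (fun _ => {r | rank (r u) = rank (r v)}) fun _ =>
      roundMeasure_rank_eq huv
  refine h1.trans ?_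
  have h2 : (n + 1) ^ 4 ≤ 2 ^ rankBits n := by
    rw [rankBits, mul_comm, pow_mul]
    exact Nat.pow_le_pow_left (Nat.lt_pow_succ_log_self one_lt_two n) 4
  -- The 9 counts the rounds; two of the three powers of `n` pay for the pairs and the third leaves
  -- the bound `n⁻¹`.
  have h3 : 9 * n ^ 3 ≤ (n + 1) ^ 4 := by
    rcases Nat.lt_or_ge n 3 with h | h
    · interval_cases n <;> norm_num
    · obtain ⟨m, rfl⟩ := Nat.exists_eq_add_of_le h
      ring_nf
      nlinarith [Nat.zero_le (m ^ 4), Nat.zero_le (m ^ 3), Nat.zero_le (m ^ 2)]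
  have h4 : (9 * n ^ 3 : ℝ) ≤ 2 ^ rankBits n := by exact_mod_cast h3.trans h2
  have hn' : (0 : ℝ) < n := by exact_mod_cast hn
  rw [inv_pow, ← one_div, ← one_div, le_div_iff₀ hn',
    show 9 * ((n : ℝ) ^ 2 * (1 / 2 ^ rankBits n)) * n = 9 * n ^ 3 / 2 ^ rankBits n by ring]
  exact (div_le_one (by positivity)).2 h4

/-! ### The theorem -/

lemma holdsWhp_of_le {b : ℕ} {c : ℝ} {E : CoinSpace n b → Prop}
    (h : (coinMeasure n b).real {ω | ¬ E ω} ≤ 1 / (n : ℝ) ^ c) : HoldsWhp n b c E := by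
  have h1 : (coinMeasure n b).real Set.univ ≤
      (coinMeasure n b).real {ω | E ω} + (coinMeasure n b).real {ω | ¬ E ω} := by
    refine le_trans (measureReal_mono (fun ω _ => ?_) (by finiteness)) (measureReal_union_le _ _)
    exact em (E ω)
  rw [probReal_univ] at h1
  unfold HoldsWhp
  linarith

/-- The total failure probability of the message bound, up to a factor `base n`. -/
def failureConst : ℕ := 9 * (2 ^ 16 + 4 + refereeConst) + 1

/-- Networks of at most this size are small. -/
def smallSize : ℕ := (4 * failureConst ^ 2) ^ 16

/-- Since `n ^ (1/32) ≤ √(2 * base n)`, passing to half the exponent 1/16 gains a factor of order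
`√(base n)`, which beats the constant once `base n ≥ 2 * failureConst ^ 2`. -/
lemma failure_le (hn : smallSize < n) : failureConst * (base n)⁻¹ ≤ 1 / (n : ℝ) ^ (1 / 32 : ℝ) := by
  have h0 : 0 < base n := one_pos.trans_le one_le_base
  have hn0 : (0 : ℝ) < n := by exact_mod_cast (Nat.zero_le _).trans_lt hn
  have hb : 2 * (failureConst : ℝ) ^ 2 ≤ base n := by
    by_contra hcon
    have h1 : (n : ℝ) ≤ (4 * (failureConst : ℝ) ^ 2) ^ 16 :=
      lt_two_mul_base_pow.le.trans (pow_le_pow_left₀ (by positivity) (by linarith) 16)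
    have h2 : (smallSize : ℝ) < n := by exact_mod_cast hn
    rw [smallSize] at h2
    push_cast at h2
    linarith
  have hroot : (n : ℝ) ^ (1 / 32 : ℝ) ≤ Real.sqrt (2 * base n) := by
    rw [Real.sqrt_eq_rpow]
    calc (n : ℝ) ^ (1 / 32 : ℝ) ≤ ((2 * base n) ^ 16) ^ (1 / 32 : ℝ) := by
          gcongr; exact lt_two_mul_base_pow.le
      _ = (2 * base n) ^ (1 / 2 : ℝ) := by
          rw [← Real.rpow_natCast, ← Real.rpow_mul (by positivity)]
          norm_num
  have hmain : failureConst * Real.sqrt (2 * base n) ≤ base n := by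
    rw [← pow_le_pow_iff_left₀ (by positivity) h0.le two_ne_zero]
    rw [mul_pow, Real.sq_sqrt (by positivity)]
    nlinarith
  rw [le_div_iff₀ (by positivity)]
  calc failureConst * (base n)⁻¹ * (n : ℝ) ^ (1 / 32 : ℝ)
      ≤ failureConst * (base n)⁻¹ * Real.sqrt (2 * base n) := by gcongr
    _ = failureConst * Real.sqrt (2 * base n) * (base n)⁻¹ := by ring
    _ ≤ base n * (base n)⁻¹ := by gcongr
    _ = 1 := mul_inv_cancel₀ h0.ne'

lemma inv_le_one_div_rpow (hn : 0 < n) : (n : ℝ)⁻¹ ≤ 1 / (n : ℝ) ^ (1 / 32 : ℝ) := by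
  have h1 : (1 : ℝ) ≤ n := by exact_mod_cast hn
  rw [one_div]
  refine inv_anti₀ (by positivity) ?_
  calc (n : ℝ) ^ (1 / 32 : ℝ) ≤ (n : ℝ) ^ (1 : ℝ) :=
        Real.rpow_le_rpow_of_exponent_le h1 (by norm_num)
    _ = n := Real.rpow_one _

theorem holdsWhp_messageCount {ids : Fin n → Option ℕ}
    -- This form serves both networks: anonymous keys are the ranks, while identifiers are distinct
    -- whatever the ranks are.
    (hkey : ∀ ω : CoinSpace n (coinCount n),
      (∀ t < 9, ∀ u v, rank (ω t u) = rank (ω t v) → u = v) →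
      ∀ t < 9, ∀ u v, keyOf (ω t u) (ids u) = keyOf (ω t v) (ids v) → u = v) :
    HoldsWhp n (coinCount n) (1 / 32) fun ω =>
      ∀ T, messageCount (election n) ports ids adv ω T ≤ (21 + 3 * smallSize) * n := by
  apply holdsWhp_of_le
  rcases Nat.lt_or_ge smallSize n with hn | hn
  · have hn4 : 4 ≤ n := by
      have : 4 ≤ smallSize := by
        have h1 : 1 ≤ failureConst := by simp [failureConst]
        calc 4 ≤ 4 * failureConst ^ 2 := Nat.le_mul_of_pos_right _ (by positivity)
          _ ≤ smallSize := Nat.le_self_pow (by norm_num) _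
      omega
    have hsub : {ω | ¬ ∀ T, messageCount (election n) ports ids adv ω T ≤
        (21 + 3 * smallSize) * n} ⊆
        {ω | ∃ t < 9, ω ∈ {ω | ¬ Calm ports adv (2 ^ (11 * scale n)) (2 ^ (6 * scale n)) ω t}} ∪
        {ω | ∃ t < 9, ∃ u v, u ≠ v ∧ rank (ω t u) = rank (ω t v)} := by
      intro ω hω
      by_contra hcon
      simp only [Set.mem_union, not_or, Set.mem_ofPred_eq, not_exists, not_and] at hcon
      refine hω fun T => (messageCount_le_of_calm
        (fun t ht => not_not.1 (hcon.1 t ht)) (hkey ω fun t ht u v huv => ?_) T).trans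
        (Nat.mul_le_mul_right _ (Nat.le_add_right _ _))
      by_contra hne
      exact hcon.2 t ht u v hne huv
    refine (measureReal_mono hsub (by finiteness)).trans ((measureReal_union_le _ _).trans ?_)
    refine le_trans ?_ (failure_le hn)
    have h1 := coinMeasure_exists_lt_nine_le
      (fun t => {ω | ¬ Calm ports adv (2 ^ (11 * scale n)) (2 ^ (6 * scale n)) ω t})
      (fun t => coinMeasure_not_calm_le (ports := ports) (adv := adv) hn4 t)
    have h2 := coinMeasure_rank_eq_le (n := n) (by omega)
    have h0 : 0 < base n := one_pos.trans_le one_le_base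
    have h3 : (n : ℝ)⁻¹ ≤ (base n)⁻¹ := by
      apply inv_anti₀ h0
      exact (le_self_pow₀ one_le_base (by norm_num)).trans (base_pow_le (by omega))
    have h4 : (failureConst : ℝ) * (base n)⁻¹ =
        9 * ((2 ^ 16 + 4 + refereeConst : ℕ) * (base n)⁻¹) + (base n)⁻¹ := by
      rw [failureConst, Nat.cast_add, Nat.cast_mul]
      push_cast
      ring
    exact (add_le_add h1 (h2.trans h3)).trans_eq h4.symm
  -- For small networks the certain quadratic bound is linear, with `smallSize` in the constant.
  · have : {ω | ¬ ∀ T, messageCount (election n) ports ids adv ω T ≤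
        (21 + 3 * smallSize) * n} = ∅ := by
      ext ω
      simp only [Set.mem_ofPred_eq, Set.mem_empty_iff_false, iff_false, not_not]
      intro T
      calc messageCount (election n) ports ids adv ω T ≤ 3 * (n * n) := messageCount_le_sq T
        _ ≤ 3 * (smallSize * n) := by gcongr
        _ ≤ (21 + 3 * smallSize) * n := by rw [← mul_assoc]; gcongr; omega
    refine (congrArg (coinMeasure n (coinCount n)).real this).trans_le ?_
    exact (measureReal_empty (μ := coinMeasure n (coinCount n))).trans_le (by positivity)

theorem holdsWhp_electedAt_anonymous (hn : 0 < n) :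
    HoldsWhp n (coinCount n) (1 / 32) fun ω =>
      ElectedAt (election n) ports anonymous adv ω 9 := by
  apply holdsWhp_of_le
  refine le_trans ?_ (inv_le_one_div_rpow hn)
  refine (measureReal_mono (fun ω hω => ?_) (by finiteness)).trans (coinMeasure_rank_eq_le hn)
  by_contra hcon
  simp only [Set.mem_ofPred_eq, not_exists, not_and] at hcon
  refine hω (electedAt_nine (fun t ht u v huv => ?_) fun _ _ _ => rfl)
  by_contra hne
  exact hcon t (by omega) u v hne huv

end Bounds

end SyncElection

open SyncElection in
theorem theorem2 :
    ∃ alg : (n : ℕ) → Protocol n, ∃ c : ℝ, 0 < c ∧ ∃ C K : ℕ,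
      -- anonymous networks
      (∀ (n : ℕ) (ports : Ports n) (adv : Adversary n (alg n).coins),
        (∀ ω, TerminatedAt (alg n) ports anonymous adv ω 9) ∧
        (∀ ω, MessageBitsLE (alg n) ports anonymous adv ω (K * Nat.log 2 n)) ∧
        HoldsWhp n (alg n).coins c (fun ω => ElectedAt (alg n) ports anonymous adv ω 9) ∧
        HoldsWhp n (alg n).coins c (fun ω =>
          ∀ T, messageCount (alg n) ports anonymous adv ω T ≤ C * n)) ∧
      -- networks with unique identifiers
      (∀ (n : ℕ) (ports : Ports n) (ident : Fin n → ℕ), Function.Injective ident →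
        ∀ adv : Adversary n (alg n).coins,
        (∀ ω, TerminatedAt (alg n) ports (withIds ident) adv ω 9) ∧
        (∀ ω, ElectedAt (alg n) ports (withIds ident) adv ω 9) ∧
        HoldsWhp n (alg n).coins c (fun ω =>
          ∀ T, messageCount (alg n) ports (withIds ident) adv ω T ≤ C * n)) ∧
      -- identifiers of `O(log n)` bits lead to messages of `O(log n)` bits
      (∀ k : ℕ, ∃ K' : ℕ, ∀ (n : ℕ) (ports : Ports n) (ident : Fin n → ℕ),
        Function.Injective ident → (∀ v, ident v ≤ n ^ k) →
        ∀ (adv : Adversary n (alg n).coins) (ω : CoinSpace n (alg n).coins),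
        MessageBitsLE (alg n) ports (withIds ident) adv ω (K' * Nat.log 2 n)) := by
  refine ⟨election, 1 / 32, by norm_num, 21 + 3 * smallSize, 10, fun n ports adv => ?_,
    fun n ports ident hident adv => ?_, fun k => ?_⟩
  -- The network is nonempty because the adversary wakes some node in round 0.
  · have hn : 0 < n := (adv.wake_zero fun i => i.elim0).choose.pos
    exact ⟨fun ω => terminatedAt_nine, fun ω => messageBitsLE_anonymous,
      holdsWhp_electedAt_anonymous hn, holdsWhp_messageCount fun ω h => h⟩
  · exact ⟨fun ω => terminatedAt_nine,
      fun ω => electedAt_nine (fun t _ u v h => hident h) fun _ _ _ => rfl,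
      holdsWhp_messageCount fun ω _ t _ u v h => hident h⟩
  · exact ⟨2 * k + 3, fun n ports ident _ hle adv ω => messageBitsLE_withIds hle⟩
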